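/- Let $n\ge r$ and let $\mathcal M=\{X\in\mathbb R^{n\times r}: X^{\mathsf T}X=I_r\}$. Consider $$\min_{X\in\mathcal M}\; f(X)-g(X)+h(\mathcal A(X)),$$ where $\mathcal A:\mathbb R^{n\times r}\to\mathbb R^m$ is linear with adjoint $\mathcal A^{\mathsf T}$ and operator norm $\overline{\mathrm A}$ (Frobenius norm on matrices, Euclidean norm on vectors); $f$ is differentiable, $\nabla f$ is $L_f$-Lipschitz on $\mathbb R^{n\times r}$ and $\|\nabla f\|_{\mathsf F}\le C_f$ on $\mathcal M$; $g$ is real-valued, convex and $C_g$-Lipschitz; $h$ is real-valued, $C_h$-Lipschitz, and $h+\frac{W_h}{2}\|\cdot\|^2$ is convex for a constant $W_h\ge 0$. Let $\partial$ denote the limiting subdifferential, $h_\mu(y)=\min_u\, h(u)+\frac1{2\mu}\|u-y\|^2$ the Moreau envelope, $\mathrm{Proj}_{\mathrm T_X\mathcal M}(\Delta)=\Delta-\frac12X(\Delta^{\mathsf T}X+X^{\mathsf T}\Delta)$, and $$\mathrm{Crit}(X,y,z)=\|\mathcal A(X)-y\|+\inf_{w\in\partial h(y)}\|w-z\|+\inf_{v\in\partial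 g(X)}\big\|\mathrm{Proj}_{\mathrm T_X\mathcal M}\big(\nabla f(X)-v+\mathcal A^{\mathsf T}(z)\big)\big\|_{\mathsf F}.$$ A triple $(X,y,z)$ with $X\in\mathcal M$ and $\mathrm{Crit}(X,y,z)\le\epsilon$ is called an $\epsilon$-stationary point. Put $\mathcal S(X,y,z,\beta)=f(X)+\langle z,\mathcal A(X)-y\rangle+\frac\beta2\|\mathcal A(X)-y\|^2$ and $\ell(\beta)=\beta\overline{\mathrm A}^2+L_f$. Choose $p\in(0,1)$, $\xi\in(0,1]$, $\theta>1$, $\sigma\in[1,2)$, $\tau\ge\frac4{2-\sigma}$, $\beta^0>0$ with $\beta^0\ge2\tau W_h$, and $\alpha\in\big[0,\frac{\theta-1}{(\theta+1)(\xi+2)}\big)$. Given $X^{-1},X^0\in\mathbb R^{n\times r}$ and $y^0,z^0\in\mathbb R^m$, a run of OADMM-EP performs, for $t=0,1,2,\dots$, with $\beta^t=\beta^0(1+\xi t^p)$ and $\mu^t=\tau/\beta^t$: 1. $X_{\mathsf c}^t=X^t+\alpha(X^t-X^{t-1})$; choose $G^t\in\nabla_X\mathcal S(X_{\mathsf c}^t,y^t,z^t,\beta^t)-\partial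 g(X^t)$ and $X^{t+1}\in\arg\min_{X\in\mathcal M}\langle X-X^t,G^t\rangle+\frac{\theta\ell(\beta^t)}2\|X-X_{\mathsf c}^t\|_{\mathsf F}^2$; 2. $b^t=y^t-\frac1{\beta^t}\nabla_y\mathcal S(X^{t+1},y^t,z^t,\beta^t)$, $\;y^{t+1}=\arg\min_y\,h_{\mu^t}(y)+\frac{\beta^t}2\|y-b^t\|^2$, $\;\breve y^{t+1}=\arg\min_u\,h(u)+\frac1{2(\mu^t+1/\beta^t)}\|u-b^t\|^2$; 3. $z^{t+1}=z^t+\sigma\beta^t(\mathcal A(X^{t+1})-y^{t+1})$. **Theorem.** Let $p=1/3$. There are positive constants $C_1,C_2,C,K$, depending only on the problem, on the parameters and on $X^0,y^0,z^0$, such that for every run of OADMM-EP and every integer $T\ge1$ $$\frac1T\sum_{t=1}^T\mathrm{Crit}(X^{t+1},\breve y^{t+1},z^{t+1})\le C_1T^{(p-1)/2}+C_2T^{-p}\quad\text{and}\quad \frac1T\sum_{t=1}^T\mathrm{Crit}(X^{t+1},\breve y^{t+1},z^{t+1})\le C\,T^{-1/3}.$$ Moreover, for every $\epsilon>0$ and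 every integer $T\ge1$ with $T\ge K/\epsilon^3$ there is $\bar t\in\{1,\dots,T\}$ such that $(X^{\bar t+1},\breve y^{\bar t+1},z^{\bar t+1})$ is an $\epsilon$-stationary point. -/

import Mathlib

open Set Filter Topology
open scoped NNReal Matrix Gradient

noncomputable section

namespace OADMM

/-- The space of real `n × r` matrices with the Frobenius inner product and norm
(coordinates are indexed by pairs `(i, j)`). -/
abbrev MatSp (n r : ℕ) := EuclideanSpace ℝ (Fin n × Fin r)

/-- Euclidean space `ℝ^m`. -/
abbrev Vec (m : ℕ) := EuclideanSpace ℝ (Fin m)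

/-- The matrix with the given coordinates. -/
def toMat {n r : ℕ} (X : MatSp n r) : Matrix (Fin n) (Fin r) ℝ :=
  Matrix.of fun i j => X (i, j)

/-- The point of `MatSp n r` given by a matrix. -/
def ofMat {n r : ℕ} (M : Matrix (Fin n) (Fin r) ℝ) : MatSp n r :=
  WithLp.toLp 2 fun ij => M ij.1 ij.2

/-- The Stiefel manifold `{X : Xᵀ X = I_r}`. -/
def stiefel (n r : ℕ) : Set (MatSp n r) :=
  {X | (toMat X)ᵀ * toMat X = 1}

/-- Orthogonal projection onto the tangent space of the Stiefel manifold at `X`: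
`Δ - (1/2) X (Δᵀ X + Xᵀ Δ)`. -/
def projTangent {n r : ℕ} (X Δ : MatSp n r) : MatSp n r :=
  Δ - ofMat ((1 / 2 : ℝ) •
    (toMat X * ((toMat Δ)ᵀ * toMat X + (toMat X)ᵀ * toMat Δ)))

section Subdifferential

variable {E : Type*} [NormedAddCommGroup E] [InnerProductSpace ℝ E]

/-- Fréchet subdifferential of a finite-valued function:
`v` such that `liminf_{z → x, z ≠ x} (F z - F x - ⟪v, z - x⟫) / ‖z - x‖ ≥ 0`. -/
def frechetSubdiff (F : E → ℝ) (x : E) : Set E :=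
  {v | ∀ ε : ℝ, 0 < ε → ∀ᶠ z in 𝓝 x, -(ε * ‖z - x‖) ≤ F z - F x - inner ℝ v (z - x)}

/-- Limiting subdifferential of a finite-valued function. -/
def subdiff (F : E → ℝ) (x : E) : Set E :=
  {v | ∃ (xs : ℕ → E) (vs : ℕ → E), Tendsto xs atTop (𝓝 x) ∧
    Tendsto (fun k => F (xs k)) atTop (𝓝 (F x)) ∧
    (∀ k, vs k ∈ frechetSubdiff F (xs k)) ∧ Tendsto vs atTop (𝓝 v)}

/-- The objective `u ↦ h u + ‖u - y‖² / (2 μ)` of the proximal problem at `y`. -/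
def proxObj (h : E → ℝ) (μ : ℝ) (y u : E) : ℝ :=
  h u + 1 / (2 * μ) * ‖u - y‖ ^ 2

/-- The Moreau envelope `h_μ y = min_u h u + ‖u - y‖² / (2 μ)`. -/
def moreau (h : E → ℝ) (μ : ℝ) (y : E) : ℝ :=
  ⨅ u, proxObj h μ y u

end Subdifferential

/-- The data of the problem `min f X - g X + h (A X)` subject to `Xᵀ X = I_r`, together with
the constants of its standing assumptions. -/
structure Problem (n r m : ℕ) where
  f : MatSp n r → ℝ
  g : MatSp n r → ℝ
  h : Vec m → ℝ
  A : MatSp n r →L[ℝ] Vec m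
  Lf : ℝ≥0
  Cf : ℝ≥0
  Cg : ℝ≥0
  Ch : ℝ≥0
  Wh : ℝ≥0

namespace Problem

variable {n r m : ℕ} (D : Problem n r m)

/-- The standing assumptions on the problem. -/
structure Assumptions : Prop where
  f_differentiable : Differentiable ℝ D.f
  f_smooth : LipschitzWith D.Lf (∇ D.f)
  f_grad_bound : ∀ X ∈ stiefel n r, ‖∇ D.f X‖ ≤ D.Cf
  g_convex : ConvexOn ℝ univ D.g
  g_lipschitz : LipschitzWith D.Cg D.g
  h_lipschitz : LipschitzWith D.Ch D.h
  h_weakly_convex : ConvexOn ℝ univ fun y => D.h y + (D.Wh : ℝ) / 2 * ‖y‖ ^ 2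

/-- The adjoint `Aᵀ` of the linear map. -/
def adj : Vec m →L[ℝ] MatSp n r := ContinuousLinearMap.adjoint D.A

/-- The smooth part `f X + ⟪z, A X - y⟫ + (β/2) ‖A X - y‖²` of the augmented Lagrangian. -/
def S (X : MatSp n r) (y z : Vec m) (β : ℝ) : ℝ :=
  D.f X + inner ℝ z (D.A X - y) + β / 2 * ‖D.A X - y‖ ^ 2

/-- `ℓ(β) = β Ā² + L_f`, where `Ā` is the operator norm of `A`. -/
def ell (β : ℝ) : ℝ := β * ‖D.A‖ ^ 2 + D.Lf

/-- The criticality measure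
`‖A X - y‖ + dist (z, ∂h y) + dist (0, Proj_{T_X} (∇f X - ∂g X + Aᵀ z))`.
Both sets are nonempty for the functions considered. -/
def crit (X : MatSp n r) (y z : Vec m) : ℝ :=
  ‖D.A X - y‖ + Metric.infDist z (subdiff D.h y) +
    Metric.infDist 0 ((fun v => projTangent X (∇ D.f X - v + D.adj z)) '' subdiff D.g X)

/-- `ε`-stationary points. -/
def IsStationary (ε : ℝ) (X : MatSp n r) (y z : Vec m) : Prop :=
  X ∈ stiefel n r ∧ D.crit X y z ≤ ε

end Problem

/-- The parameters of the algorithm. -/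
structure Params where
  p : ℝ
  ξ : ℝ
  θ : ℝ
  σ : ℝ
  τ : ℝ
  β₀ : ℝ
  α : ℝ

namespace Params

variable (P : Params)

/-- The admissible parameter choices; `W` is the weak convexity constant of `h`. -/
structure Admissible (W : ℝ) : Prop where
  p_pos : 0 < P.p
  p_lt_one : P.p < 1
  ξ_pos : 0 < P.ξ
  ξ_le_one : P.ξ ≤ 1
  one_lt_θ : 1 < P.θ
  one_le_σ : 1 ≤ P.σ
  σ_lt_two : P.σ < 2
  le_τ : 4 / (2 - P.σ) ≤ P.τ
  β₀_pos : 0 < P.β₀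
  le_β₀ : 2 * P.τ * W ≤ P.β₀
  α_nonneg : 0 ≤ P.α
  α_lt : P.α < (P.θ - 1) / ((P.θ + 1) * (P.ξ + 2))

/-- The penalty parameter `β^t = β^0 (1 + ξ t^p)`. -/
def β (t : ℕ) : ℝ := P.β₀ * (1 + P.ξ * (t : ℝ) ^ P.p)

/-- The smoothing parameter `μ^t = τ / β^t`. -/
def μ (t : ℕ) : ℝ := P.τ / P.β t

end Params

/-- The iterates `X^t`, `y^t`, `z^t`, and `y̆^t` of a run, together with the point `X^{-1}` that
the extrapolation uses at `t = 0`. The value `yb 0` is never used. -/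
structure Iterates (n r m : ℕ) where
  Xinit : MatSp n r
  X : ℕ → MatSp n r
  y : ℕ → Vec m
  z : ℕ → Vec m
  yb : ℕ → Vec m

namespace Iterates

variable {n r m : ℕ} (D : Problem n r m) (P : Params) (R : Iterates n r m)

/-- The previous point `X^{t-1}`. -/
def prev : ℕ → MatSp n r
  | 0 => R.Xinit
  | t + 1 => R.X t

/-- The extrapolated point `X_c^t = X^t + α (X^t - X^{t-1})`. -/
def Xc (t : ℕ) : MatSp n r := R.X t + P.α • (R.X t - R.prev t)

/-- `∇_X S (X_c^t, y^t, z^t, β^t)`. -/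
def gradX (t : ℕ) : MatSp n r :=
  ∇ (fun X => D.S X (R.y t) (R.z t) (P.β t)) (R.Xc P t)

/-- `b = y^t - ∇_y S (X^{t+1}, y^t, z^t, β^t) / β^t`. -/
def b (t : ℕ) : Vec m :=
  R.y t - (1 / P.β t) • ∇ (fun y => D.S (R.X (t + 1)) y (R.z t) (P.β t)) (R.y t)

/-- `R` is a run of the Euclidean projection variant OADMM-EP. The subgradients of `g` and the
minimizers over the Stiefel manifold may be chosen arbitrarily at every iteration. -/
structure IsRunEP : Prop where
  X_step : ∀ t, ∃ v ∈ subdiff D.g (R.X t),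
    R.X (t + 1) ∈ stiefel n r ∧
    IsMinOn (fun X => inner ℝ (X - R.X t) (R.gradX D P t - v) +
      P.θ * D.ell (P.β t) / 2 * ‖X - R.Xc P t‖ ^ 2) (stiefel n r) (R.X (t + 1))
  y_step : ∀ t, IsMinOn (fun y => moreau D.h (P.μ t) y + P.β t / 2 * ‖y - R.b D P t‖ ^ 2)
    univ (R.y (t + 1))
  yb_step : ∀ t, IsMinOn (proxObj D.h (P.μ t + 1 / P.β t) (R.b D P t)) univ (R.yb (t + 1))
  z_step : ∀ t, R.z (t + 1) = R.z t + (P.σ * P.β t) • (D.A (R.X (t + 1)) - R.y (t + 1))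

/-- The average `(1/T) ∑_{t=1}^T Crit (X^{t+1}, y̆^{t+1}, z^{t+1})`. -/
def avgCrit (T : ℕ) : ℝ :=
  1 / (T : ℝ) * ∑ t ∈ Finset.Icc 1 T, D.crit (R.X (t + 1)) (R.yb (t + 1)) (R.z (t + 1))

end Iterates

end OADMM

end

/-!
The proof is a potential-function argument for the smoothed augmented Lagrangian
`f - g + h_μ + ⟪z, A X - y⟫ + β/2 ‖A X - y‖²`.

*Dual side.* The two proximal problems of the `y`-step share their optimality condition
(`eq_of_isMinOn_moreau`): the multiplier `w = z^t + (z^{t+1} - z^t) / σ` is a subgradient of `h` at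
`y̆^{t+1}` and `y^{t+1} = y̆^{t+1} + μ^t w`. Hence `‖w‖ ≤ C_h`, and `z^{t+1} = (1 - σ) z^t + σ w` stays
bounded because `|1 - σ| < 1`. Weak convexity makes `w` a Lipschitz function of `y` with constant
`1 / μ = β / τ`, up to the change of `μ`. Thus `‖z^{t+1} - z^t‖² / β` is dominated by
`β ‖y^{t+1} - y^t‖²`, which the strong convexity of the `y`-step pays for when `τ ≥ 4 / (2 - σ)`
(`dual_increment_le`). The changes of `β` and `μ` cost multiples of `1 / β^t - 1 / β^{t+1}`, which
telescope.

*Primal side.* The minimizer `X^{t+1}` of the model is compared with a point on a Cayley curve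
through `X^t`, started in the direction `X Gᵀ - G Xᵀ` for the model gradient `G` at `X^t`. Since
projecting `G` to the tangent space factors through this skew-symmetric matrix, the model decreases
by at least a multiple of `‖Proj G‖² / β` (`exists_isStiefelDescentConst`). This bounds the projected
gradient at `X^t` itself, with the very subgradient of `g` that the algorithm uses there, so that no
optimality condition at `X^{t+1}` and no lower bound of `ℓ(β)` is needed. The bound on `α` leaves a
positive multiple of `ℓ(β) ‖X^{t+1} - X^t‖²`.

Together the potential decreases by a multiple of
`‖Proj G‖² / β + ℓ(β) ‖X^{t+1} - X^t‖² + ‖z^{t+1} - z^t‖² / β` (`energy_step`), while `Crit` is at most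
`O(1 / β)` plus the square roots of `β` times these terms (`crit_le`). Cauchy–Schwarz against
`∑ β^t = O(T^{1+p})`, and `∑ t^{-p} = O(T^{1-p})`, give the rates (`average_le`). The iteration `t = 0`
serves only to bring the iterates into a bounded set, so nothing depends on `X^{-1}`.
-/

noncomputable section

namespace OADMM

/-! ### Cayley curves and descent on the Stiefel manifold -/

section Stiefel

open scoped Matrix.Norms.Frobenius

variable {n r : ℕ}

lemma toMat_ofMat (M : Matrix (Fin n) (Fin r) ℝ) : toMat (ofMat M) = M := rfl

lemma ofMat_toMat (X : MatSp n r) : ofMat (toMat X) = X := rfl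

lemma toMat_sub (X Y : MatSp n r) : toMat (X - Y) = toMat X - toMat Y := rfl

lemma norm_eq_frobenius (X : MatSp n r) : ‖X‖ = ‖toMat X‖ := by
  rw [EuclideanSpace.norm_eq, Matrix.frobenius_norm_def, Real.sqrt_eq_rpow, Fintype.sum_prod_type]
  simp [toMat]

lemma norm_ofMat (M : Matrix (Fin n) (Fin r) ℝ) : ‖ofMat M‖ = ‖M‖ := by
  rw [norm_eq_frobenius, toMat_ofMat]

lemma inner_eq_trace (X Y : MatSp n r) :
    inner ℝ X Y = ((toMat X)ᵀ * toMat Y).trace := by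
  simp only [PiLp.inner_apply, Fintype.sum_prod_type, Matrix.trace, Matrix.diag, Matrix.mul_apply,
    Matrix.transpose_apply, toMat, Matrix.of_apply]
  rw [Finset.sum_comm]
  simp [mul_comm]

lemma frobenius_sq_eq_trace (M : Matrix (Fin n) (Fin r) ℝ) : ‖M‖ ^ 2 = (Mᵀ * M).trace := by
  rw [← norm_ofMat, ← real_inner_self_eq_norm_sq, inner_eq_trace, toMat_ofMat]

lemma norm_of_mem_stiefel {X : MatSp n r} (hX : X ∈ stiefel n r) : ‖X‖ = √r := by
  rw [eq_comm, Real.sqrt_eq_iff_mul_self_eq (by positivity) (norm_nonneg _), ← sq,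
    norm_eq_frobenius, frobenius_sq_eq_trace, show (toMat X)ᵀ * toMat X = 1 from hX]
  simp

/-- `1 - a Ω` is invertible for skew-symmetric `Ω`, since `v = a Ω v` forces `⟪v, v⟫ = 0`. -/
lemma isUnit_one_sub_smul_skew {Ω : Matrix (Fin n) (Fin n) ℝ} (hΩ : Ωᵀ = -Ω) (a : ℝ) :
    IsUnit (1 - a • Ω) := by
  rw [← Matrix.mulVec_injective_iff_isUnit]
  intro v w hvw
  rw [← sub_eq_zero]
  set x := v - w with hx
  have h0 : (1 - a • Ω) *ᵥ x = 0 := by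
    rw [hx, Matrix.mulVec_sub]; exact sub_eq_zero.mpr hvw
  rw [Matrix.sub_mulVec, Matrix.one_mulVec, Matrix.smul_mulVec, sub_eq_zero] at h0
  have h1 : x ⬝ᵥ (Ω *ᵥ x) = 0 := by
    have h2 : x ⬝ᵥ (Ω *ᵥ x) = -(x ⬝ᵥ (Ω *ᵥ x)) := by
      conv_lhs => rw [Matrix.dotProduct_mulVec, ← Matrix.mulVec_transpose, hΩ,
        Matrix.neg_mulVec, neg_dotProduct, dotProduct_comm]
    linarith
  have h3 : x ⬝ᵥ x = 0 := by
    conv_lhs => rw [h0]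
    rw [smul_dotProduct]
    rw [dotProduct_comm, ← h0, h1, smul_zero]
  exact dotProduct_self_eq_zero.mp h3

/-- The Cayley transform: moving along a skew-symmetric direction inside the Stiefel manifold. -/
lemma exists_cayley {X : MatSp n r} (hX : X ∈ stiefel n r) {Ω : Matrix (Fin n) (Fin n) ℝ}
    (hΩ : Ωᵀ = -Ω) (a : ℝ) :
    ∃ Y ∈ stiefel n r, toMat Y - toMat X = a • (Ω * (toMat X + toMat Y)) := by
  obtain ⟨B, hB⟩ := isUnit_one_sub_smul_skew hΩ a
  set M := toMat X with hM
  set N := (↑B⁻¹ : Matrix (Fin n) (Fin n) ℝ) * ((1 + a • Ω) * M) with hN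
  have hBN : (1 - a • Ω) * N = (1 + a • Ω) * M := by
    rw [hN, ← hB, ← Matrix.mul_assoc, Units.mul_inv, Matrix.one_mul]
  have hd : N - M = a • (Ω * (M + N)) := by
    rw [Matrix.sub_mul, Matrix.add_mul, Matrix.one_mul, Matrix.one_mul, Matrix.smul_mul,
      Matrix.smul_mul] at hBN
    rw [Matrix.mul_add, smul_add, sub_eq_iff_eq_add]
    rw [sub_eq_iff_eq_add] at hBN
    exact hBN.trans (by abel)
  refine ⟨ofMat N, ?_, by rw [toMat_ofMat]; exact hd⟩
  change Nᵀ * N = 1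
  have hX' : Mᵀ * M = 1 := hX
  have h2 : (2 : ℝ) • (Nᵀ * N - Mᵀ * M) = (N - M)ᵀ * (M + N) + (M + N)ᵀ * (N - M) := by
    rw [two_smul]
    simp only [Matrix.transpose_sub, Matrix.transpose_add, Matrix.sub_mul, Matrix.mul_sub,
      Matrix.add_mul, Matrix.mul_add]
    abel
  have h3 : (N - M)ᵀ * (M + N) + (M + N)ᵀ * (N - M) = 0 := by
    rw [hd, Matrix.transpose_smul, Matrix.transpose_mul, hΩ]
    simp [Matrix.mul_assoc]
  rw [h3, smul_eq_zero_iff_right two_ne_zero, hX', sub_eq_zero] at h2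
  exact h2

/-- The skew-symmetric matrix `X Gᵀ - G Xᵀ`, whose product with `X` is a descent direction. -/
def skewDir (X G : MatSp n r) : Matrix (Fin n) (Fin n) ℝ :=
  toMat X * (toMat G)ᵀ - toMat G * (toMat X)ᵀ

lemma skewDir_transpose (X G : MatSp n r) : (skewDir X G)ᵀ = -skewDir X G := by
  simp [skewDir, Matrix.transpose_sub, Matrix.transpose_mul]

lemma inner_skewDir_mul (X G : MatSp n r) :
    inner ℝ (ofMat (skewDir X G * toMat X)) G = -(1 / 2) * ‖skewDir X G‖ ^ 2 := by
  rw [inner_eq_trace, frobenius_sq_eq_trace, toMat_ofMat, Matrix.transpose_mul, skewDir_transpose]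
  set M := toMat X
  set N := toMat G
  have e : skewDir X G = M * Nᵀ - N * Mᵀ := rfl
  have h1 : (Mᵀ * -skewDir X G * N).trace = -(skewDir X G * (N * Mᵀ)).trace := by
    rw [Matrix.mul_neg, Matrix.neg_mul, Matrix.trace_neg, Matrix.mul_assoc, Matrix.trace_mul_comm,
      Matrix.mul_assoc]
  have h2 : (skewDir X G * (M * Nᵀ)).trace = -(skewDir X G * (N * Mᵀ)).trace := by
    rw [← Matrix.trace_transpose, Matrix.transpose_mul, skewDir_transpose, Matrix.transpose_mul,
      Matrix.transpose_transpose, Matrix.mul_neg, Matrix.trace_neg, Matrix.trace_mul_comm]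
  have h3 : (-skewDir X G * skewDir X G).trace = 2 * (skewDir X G * (N * Mᵀ)).trace := by
    rw [Matrix.neg_mul, Matrix.trace_neg]
    conv_lhs => rw [show skewDir X G * skewDir X G = skewDir X G * (M * Nᵀ) - skewDir X G * (N * Mᵀ)
      from by rw [← Matrix.mul_sub, ← e]]
    rw [Matrix.trace_sub, h2]; ring
  rw [h1, h3]; ring

lemma projTangent_eq_skewDir {X : MatSp n r} (hX : X ∈ stiefel n r) (G : MatSp n r) :
    toMat (projTangent X G) = -(skewDir X G * toMat X -
      (1 / 2 : ℝ) • (toMat X * ((toMat X)ᵀ * (skewDir X G * toMat X)))) := by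
  have hX' : (toMat X)ᵀ * toMat X = 1 := hX
  have h1 : skewDir X G * toMat X = toMat X * ((toMat G)ᵀ * toMat X) - toMat G := by
    rw [skewDir, Matrix.sub_mul, Matrix.mul_assoc, Matrix.mul_assoc, hX', Matrix.mul_one]
  rw [h1, Matrix.mul_sub, ← Matrix.mul_assoc (toMat X)ᵀ, hX', Matrix.one_mul, projTangent, toMat_sub,
    toMat_ofMat, Matrix.mul_sub, Matrix.mul_add, smul_add, smul_sub]
  module

lemma norm_projTangent_le_skewDir {X : MatSp n r} (hX : X ∈ stiefel n r) (G : MatSp n r) :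
    ‖projTangent X G‖ ≤ (√r + 1 / 2 * (√r * (√r * √r))) * ‖skewDir X G‖ := by
  have hn : ‖toMat X‖ = √r := by rw [← norm_eq_frobenius, norm_of_mem_stiefel hX]
  have hnt : ‖(toMat X)ᵀ‖ = √r := by rw [Matrix.frobenius_norm_transpose, hn]
  have h1 : ‖skewDir X G * toMat X‖ ≤ ‖skewDir X G‖ * √r := by
    rw [← hn]; exact Matrix.frobenius_norm_mul _ _
  have h2 : ‖toMat X * ((toMat X)ᵀ * (skewDir X G * toMat X))‖
      ≤ √r * (√r * (‖skewDir X G‖ * √r)) := by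
    refine (Matrix.frobenius_norm_mul _ _).trans ?_
    rw [hn]
    gcongr
    refine (Matrix.frobenius_norm_mul _ _).trans ?_
    rw [hnt]
    gcongr
  rw [norm_eq_frobenius, projTangent_eq_skewDir hX, norm_neg]
  refine (norm_sub_le _ _).trans ?_
  rw [norm_smul]
  rw [Real.norm_of_nonneg (by norm_num : (0 : ℝ) ≤ 1 / 2)]
  linarith

lemma projTangent_sub (X U V : MatSp n r) :
    projTangent X U - projTangent X V = projTangent X (U - V) := by
  have : toMat (projTangent X U - projTangent X V) = toMat (projTangent X (U - V)) := by
    simp only [projTangent, toMat_sub, toMat_ofMat, Matrix.transpose_sub, Matrix.sub_mul,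
      Matrix.mul_sub, Matrix.mul_add, smul_add, smul_sub]
    module
  rw [← ofMat_toMat (projTangent X U - projTangent X V), this, ofMat_toMat]

lemma norm_projTangent_le {X : MatSp n r} (hX : X ∈ stiefel n r) (G : MatSp n r) :
    ‖projTangent X G‖ ≤ (1 + r) * ‖G‖ := by
  have hn : ‖toMat X‖ = √r := by rw [← norm_eq_frobenius, norm_of_mem_stiefel hX]
  have h1 : ‖(toMat G)ᵀ * toMat X + (toMat X)ᵀ * toMat G‖ ≤ 2 * (√r * ‖G‖) := by
    refine (norm_add_le _ _).trans ?_
    have a := Matrix.frobenius_norm_mul (toMat G)ᵀ (toMat X)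
    have b := Matrix.frobenius_norm_mul (toMat X)ᵀ (toMat G)
    rw [Matrix.frobenius_norm_transpose, ← norm_eq_frobenius, hn] at a
    rw [Matrix.frobenius_norm_transpose, hn, ← norm_eq_frobenius] at b
    linarith
  have h2 := Matrix.frobenius_norm_mul (toMat X) ((toMat G)ᵀ * toMat X + (toMat X)ᵀ * toMat G)
  rw [hn] at h2
  have h3 : √(r : ℝ) * √r = r := Real.mul_self_sqrt (by positivity)
  have h4 := mul_le_mul_of_nonneg_left h1 (Real.sqrt_nonneg (r : ℝ))
  refine (norm_sub_le _ _).trans ?_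
  rw [norm_ofMat, norm_smul]
  rw [Real.norm_of_nonneg (by norm_num : (0 : ℝ) ≤ 1 / 2)]
  have h5 : √(r : ℝ) * (2 * (√(r : ℝ) * ‖G‖)) = 2 * (r * ‖G‖) := by
    linear_combination (2 * ‖G‖) * h3
  linarith

/-- `κ` is a descent constant for the Stiefel manifolds with `r` columns: the model
`⟪Y - X, G⟫ + c/2 ‖Y - X‖²` can be made as small as `-(κ / ρ) ‖Proj_{T_X} G‖²` over the manifold,
where `ρ` is any bound of `‖G‖ + c`. -/
def IsStiefelDescentConst (r : ℕ) (κ : ℝ) : Prop :=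
  ∀ (n : ℕ) (X G : MatSp n r) (c ρ : ℝ), X ∈ stiefel n r → 0 ≤ c → 0 < ρ → ‖G‖ + c ≤ ρ →
    ∃ Y ∈ stiefel n r,
      inner ℝ (Y - X) G + c / 2 * ‖Y - X‖ ^ 2 ≤ -(κ / ρ) * ‖projTangent X G‖ ^ 2

/-- The Cayley curve generated by `skewDir X G`, with step length of order `1 / ρ`, attains the
required decrease: the first-order term is `-s/2 ‖Ω‖²`, and all remainders are of order
`s² ρ ‖Ω‖²`. -/
lemma exists_isStiefelDescentConst (r : ℕ) : ∃ κ : ℝ, 0 < κ ∧ IsStiefelDescentConst r κ := by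
  set q : ℝ := √(r : ℝ) with hq
  have hq0 : 0 ≤ q := Real.sqrt_nonneg _
  set s₀ : ℝ := 1 / (2 * (q + q ^ 2) + 1) with hs₀
  have hs₀p : 0 < s₀ := by positivity
  set K : ℝ := q + 1 / 2 * (q * (q * q)) + 1 with hK
  have hKp : 0 < K := by positivity
  refine ⟨s₀ / (4 * K ^ 2), by positivity, ?_⟩
  intro n X G c ρ hX hc hρ hle
  set s := s₀ / ρ with hs
  have hsp : 0 < s := by positivity
  set Ω := skewDir X G with hΩ
  obtain ⟨Y, hY, hYX⟩ := exists_cayley hX (skewDir_transpose X G) (s / 2)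
  refine ⟨Y, hY, ?_⟩
  rw [← hΩ] at hYX
  have nX : ‖toMat X‖ = q := by rw [← norm_eq_frobenius, norm_of_mem_stiefel hX]
  have nY : ‖toMat Y‖ = q := by rw [← norm_eq_frobenius, norm_of_mem_stiefel hY]
  have hd : ‖Y - X‖ ≤ s * q * ‖Ω‖ := by
    rw [norm_eq_frobenius, toMat_sub, hYX, norm_smul, Real.norm_of_nonneg (by positivity)]
    have h1 := Matrix.frobenius_norm_mul Ω (toMat X + toMat Y)
    have h2 := norm_add_le (toMat X) (toMat Y)
    rw [nX, nY] at h2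
    have h3 := mul_le_mul_of_nonneg_left h2 (norm_nonneg Ω)
    have h4 := mul_le_mul_of_nonneg_left (h1.trans h3) (by positivity : 0 ≤ s / 2)
    linarith
  have hsplit : Y - X = s • ofMat (Ω * toMat X) + (s / 2) • ofMat (Ω * toMat (Y - X)) := by
    have h1 : toMat Y - toMat X = s • (Ω * toMat X) + (s / 2) • (Ω * (toMat Y - toMat X)) := by
      rw [Matrix.mul_sub]
      rw [hYX, Matrix.mul_add]
      module
    exact congrArg ofMat h1
  have hin : inner ℝ (Y - X) G ≤ -(s / 2) * ‖Ω‖ ^ 2 + s / 2 * (‖Ω‖ * (s * q * ‖Ω‖) * ‖G‖) := by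
    rw [hsplit, inner_add_left, inner_smul_left, inner_smul_left, hΩ, inner_skewDir_mul, ← hΩ]
    have h1 : inner ℝ (ofMat (Ω * toMat (Y - X))) G ≤ ‖Ω‖ * (s * q * ‖Ω‖) * ‖G‖ := by
      refine (real_inner_le_norm _ _).trans ?_
      gcongr
      rw [norm_ofMat]
      refine (Matrix.frobenius_norm_mul _ _).trans ?_
      rw [← norm_eq_frobenius]
      gcongr
    simp only [conj_trivial]
    nlinarith
  have hd2 : ‖Y - X‖ ^ 2 ≤ (s * q * ‖Ω‖) ^ 2 := by gcongr
  have hsρ : s * (q * ‖G‖ + q ^ 2 * c) ≤ 1 / 2 := by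
    have h1 : q * ‖G‖ + q ^ 2 * c ≤ (q + q ^ 2) * ρ := by
      have := norm_nonneg G
      nlinarith [mul_nonneg hq0 hc, mul_nonneg (sq_nonneg q) this]
    calc s * (q * ‖G‖ + q ^ 2 * c) ≤ s * ((q + q ^ 2) * ρ) := by gcongr
      _ = s₀ * (q + q ^ 2) := by rw [hs]; field_simp
      _ ≤ 1 / 2 := by
        rw [hs₀, one_div_mul_eq_div, div_le_iff₀ (by positivity)]; linarith
  have hP : ‖projTangent X G‖ ^ 2 ≤ K ^ 2 * ‖Ω‖ ^ 2 := by
    rw [← mul_pow]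
    have := norm_projTangent_le_skewDir hX G
    gcongr
    refine this.trans ?_
    rw [← hΩ, ← hq, hK]
    exact mul_le_mul_of_nonneg_right (by linarith) (norm_nonneg _)
  have hmain : inner ℝ (Y - X) G + c / 2 * ‖Y - X‖ ^ 2 ≤ -(s / 4) * ‖Ω‖ ^ 2 := by
    have h1 : c / 2 * ‖Y - X‖ ^ 2 ≤ c / 2 * (s * q * ‖Ω‖) ^ 2 := by gcongr
    have h2 := mul_le_mul_of_nonneg_left hsρ (by positivity : 0 ≤ s / 2 * ‖Ω‖ ^ 2)
    linarith
  refine hmain.trans ?_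
  have h3 := mul_le_mul_of_nonneg_left hP (by positivity : 0 ≤ s₀ / (4 * K ^ 2) / ρ)
  have h4 : s₀ / (4 * K ^ 2) / ρ * (K ^ 2 * ‖Ω‖ ^ 2) = s / 4 * ‖Ω‖ ^ 2 := by
    rw [hs]; field_simp
  linarith

end Stiefel

/-! ### Subgradients of weakly convex functions and the Moreau envelope -/

section Subgradients

variable {E : Type*} [NormedAddCommGroup E] [InnerProductSpace ℝ E]

/-- A Fréchet subgradient of a convex function is a global subgradient. -/
lemma le_of_mem_frechetSubdiff {F : E → ℝ} (hF : ConvexOn ℝ univ F) {x v : E}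
    (hv : v ∈ frechetSubdiff F x) (y : E) : F x + inner ℝ v (y - x) ≤ F y := by
  have key : ∀ ε : ℝ, 0 < ε → F x + inner ℝ v (y - x) ≤ F y + ε * ‖y - x‖ := by
    intro ε hε
    have ht : Tendsto (fun s : ℝ => x + s • (y - x)) (𝓝[>] 0) (𝓝 x) := by
      have : Continuous fun s : ℝ => x + s • (y - x) := by fun_prop
      have h0 := this.tendsto 0
      simp only [zero_smul, add_zero] at h0
      exact h0.mono_left nhdsWithin_le_nhds
    have h1 : ∀ᶠ s : ℝ in 𝓝[>] 0, s < 1 := nhdsWithin_le_nhds (Iio_mem_nhds one_pos)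
    obtain ⟨s, hs, hs1, hs0⟩ :=
      ((ht.eventually (hv ε hε)).and (h1.and self_mem_nhdsWithin)).exists
    have hs0' : 0 < s := hs0
    have hc := hF.2 (mem_univ x) (mem_univ y) (by linarith : 0 ≤ 1 - s) hs0'.le (by ring)
    rw [show (1 - s) • x + s • y = x + s • (y - x) by module] at hc
    rw [add_sub_cancel_left, inner_smul_right, norm_smul, Real.norm_of_nonneg hs0'.le] at hs
    simp only [smul_eq_mul] at hc
    have : s * (F x + inner ℝ v (y - x)) ≤ s * (F y + ε * ‖y - x‖) := by linarith
    exact le_of_mul_le_mul_left this hs0'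
  refine le_of_forall_pos_le_add fun ε hε => ?_
  have h := key (ε / (‖y - x‖ + 1)) (by positivity)
  have : ε / (‖y - x‖ + 1) * ‖y - x‖ ≤ ε := by
    rw [div_mul_eq_mul_div, div_le_iff₀ (by positivity)]
    nlinarith [norm_nonneg (y - x)]
  linarith

/-- A limiting subgradient of a convex function is a global subgradient. -/
lemma le_of_mem_subdiff {F : E → ℝ} (hF : ConvexOn ℝ univ F) {x v : E}
    (hv : v ∈ subdiff F x) (y : E) : F x + inner ℝ v (y - x) ≤ F y := by
  obtain ⟨xs, vs, hx, hFx, hvs, hvl⟩ := hv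
  refine le_of_tendsto (hFx.add (hvl.inner (tendsto_const_nhds.sub hx)))
    (Eventually.of_forall fun k => le_of_mem_frechetSubdiff hF (hvs k) y)

lemma norm_le_of_mem_subdiff {F : E → ℝ} {C : ℝ≥0} (hF : ConvexOn ℝ univ F)
    (hL : LipschitzWith C F) {x v : E} (hv : v ∈ subdiff F x) : ‖v‖ ≤ C := by
  have h1 := le_of_mem_subdiff hF hv (x + v)
  have h2 := (le_abs_self _).trans (hL.dist_le_mul (x + v) x)
  rw [dist_eq_norm, add_sub_cancel_left] at h2
  rw [add_sub_cancel_left, real_inner_self_eq_norm_sq] at h1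
  rcases (norm_nonneg v).eq_or_lt with h | h
  · rw [← h]; exact C.2
  · nlinarith

lemma frechetSubdiff_subset_subdiff (F : E → ℝ) (x : E) : frechetSubdiff F x ⊆ subdiff F x :=
  fun v hv => ⟨fun _ => x, fun _ => v, tendsto_const_nhds, tendsto_const_nhds, fun _ => hv,
    tendsto_const_nhds⟩

/-- A quadratic lower bound with slope `w` makes `w` a Fréchet subgradient. -/
lemma mem_frechetSubdiff_of_quadratic {F : E → ℝ} {x w : E} {c : ℝ} (hc : 0 ≤ c)
    (h : ∀ z, F x + inner ℝ w (z - x) - c * ‖z - x‖ ^ 2 ≤ F z) : w ∈ frechetSubdiff F x := by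
  intro ε hε
  filter_upwards [Metric.ball_mem_nhds x (by positivity : 0 < ε / (c + 1))] with z hz
  rw [Metric.mem_ball, dist_eq_norm, lt_div_iff₀ (by positivity)] at hz
  have h1 := h z
  nlinarith [norm_nonneg (z - x), mul_le_mul_of_nonneg_right hz.le (norm_nonneg (z - x))]

lemma norm_le_of_mem_frechetSubdiff {F : E → ℝ} {C : ℝ≥0} (hL : LipschitzWith C F) {x w : E}
    (hw : w ∈ frechetSubdiff F x) : ‖w‖ ≤ C := by
  refine le_of_forall_pos_le_add fun ε hε => ?_
  rcases (norm_nonneg w).eq_or_lt with h | h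
  · rw [← h]; positivity
  have ht : Tendsto (fun s : ℝ => x + s • w) (𝓝[>] 0) (𝓝 x) := by
    have : Continuous fun s : ℝ => x + s • w := by fun_prop
    have h0 := this.tendsto 0
    simp only [zero_smul, add_zero] at h0
    exact h0.mono_left nhdsWithin_le_nhds
  obtain ⟨s, hs, hs0⟩ := ((ht.eventually (hw ε hε)).and self_mem_nhdsWithin).exists
  have hs0' : 0 < s := hs0
  have h2 := (le_abs_self _).trans (hL.dist_le_mul (x + s • w) x)
  rw [dist_eq_norm, add_sub_cancel_left, norm_smul, Real.norm_of_nonneg hs0'.le] at h2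
  rw [add_sub_cancel_left, inner_smul_right, norm_smul, Real.norm_of_nonneg hs0'.le,
    real_inner_self_eq_norm_sq] at hs
  have h3 : (s * ‖w‖) * ‖w‖ ≤ (s * ‖w‖) * (C + ε) := by nlinarith
  exact le_of_mul_le_mul_left h3 (by positivity)

/-- `w` is a subgradient of the `W`-weakly convex function `h` at `u`, in global form. -/
def IsWeakSubgrad (h : E → ℝ) (W : ℝ) (u w : E) : Prop :=
  ∀ z, h u + inner ℝ w (z - u) - W / 2 * ‖z - u‖ ^ 2 ≤ h z

/-- Fréchet subgradients of a weakly convex function satisfy a global inequality. -/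
lemma isWeakSubgrad_of_mem_frechetSubdiff {h : E → ℝ} {W : ℝ}
    (hW : ConvexOn ℝ univ fun y => h y + W / 2 * ‖y‖ ^ 2) {u w : E}
    (hw : w ∈ frechetSubdiff h u) (hW0 : 0 ≤ W) : IsWeakSubgrad h W u w := by
  have hmem : w + W • u ∈ frechetSubdiff (fun y => h y + W / 2 * ‖y‖ ^ 2) u := by
    intro ε hε
    filter_upwards [hw ε hε] with z hz
    have e : ‖z‖ ^ 2 = ‖u‖ ^ 2 + 2 * inner ℝ u (z - u) + ‖z - u‖ ^ 2 := by
      rw [← norm_add_sq_real, add_sub_cancel]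
    rw [inner_add_left, inner_smul_left, e]
    simp only [conj_trivial]
    nlinarith [mul_nonneg hW0 (sq_nonneg ‖z - u‖)]
  intro z
  have h1 := le_of_mem_frechetSubdiff hW hmem z
  have e : ‖z‖ ^ 2 = ‖u‖ ^ 2 + 2 * inner ℝ u (z - u) + ‖z - u‖ ^ 2 := by
    rw [← norm_add_sq_real, add_sub_cancel]
  rw [inner_add_left, inner_smul_left, e] at h1
  simp only [conj_trivial] at h1
  linarith

/-- First-order optimality for the proximal problem. -/
lemma mem_frechetSubdiff_of_isMinOn_proxObj {h : E → ℝ} {ν : ℝ} (hν : 0 < ν) {b u : E}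
    (hu : IsMinOn (proxObj h ν b) univ u) : (1 / ν) • (b - u) ∈ frechetSubdiff h u := by
  refine mem_frechetSubdiff_of_quadratic (c := 1 / (2 * ν)) (by positivity) fun z => ?_
  have h1 : proxObj h ν b u ≤ proxObj h ν b z := hu (mem_univ z)
  unfold proxObj at h1
  have e : ‖z - b‖ ^ 2 = ‖u - b‖ ^ 2 - 2 * inner ℝ (b - u) (z - u) + ‖z - u‖ ^ 2 := by
    rw [show z - b = (z - u) - (b - u) by abel, norm_sub_sq_real, norm_sub_rev b u,
      real_inner_comm]
    ring
  rw [e] at h1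
  rw [inner_smul_left]
  simp only [conj_trivial]
  have e2 : 1 / (2 * ν) * (2 * inner ℝ (b - u) (z - u)) = 1 / ν * inner ℝ (b - u) (z - u) := by
    field_simp
  linarith

end Subgradients

section Moreau

variable {E : Type*} [NormedAddCommGroup E]

lemma proxObj_ge_of_lipschitz {h : E → ℝ} {C : ℝ≥0} (hL : LipschitzWith C h) {μ : ℝ} (hμ : 0 < μ)
    (y u : E) : h y - μ / 2 * (C : ℝ) ^ 2 ≤ proxObj h μ y u := by
  have h2 := (le_abs_self _).trans (hL.dist_le_mul y u)
  rw [dist_comm, dist_eq_norm] at h2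
  have h3 : (C : ℝ) * ‖u - y‖ ≤ μ / 2 * (C : ℝ) ^ 2 + 1 / (2 * μ) * ‖u - y‖ ^ 2 := by
    have : 0 ≤ 1 / (2 * μ) * (‖u - y‖ - μ * C) ^ 2 := by positivity
    have e : 1 / (2 * μ) * (‖u - y‖ - μ * C) ^ 2
        = 1 / (2 * μ) * ‖u - y‖ ^ 2 - C * ‖u - y‖ + μ / 2 * (C : ℝ) ^ 2 := by
      field_simp; ring
    linarith
  unfold proxObj
  linarith

lemma bddBelow_proxObj {h : E → ℝ} {C : ℝ≥0} (hL : LipschitzWith C h) {μ : ℝ} (hμ : 0 < μ)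
    (y : E) : BddBelow (range (proxObj h μ y)) :=
  ⟨_, forall_mem_range.mpr (proxObj_ge_of_lipschitz hL hμ y)⟩

lemma moreau_le_proxObj {h : E → ℝ} {C : ℝ≥0} (hL : LipschitzWith C h) {μ : ℝ} (hμ : 0 < μ)
    (y u : E) : moreau h μ y ≤ proxObj h μ y u :=
  ciInf_le (bddBelow_proxObj hL hμ y) u

lemma moreau_le {h : E → ℝ} {C : ℝ≥0} (hL : LipschitzWith C h) {μ : ℝ} (hμ : 0 < μ)
    (y : E) : moreau h μ y ≤ h y := by
  simpa [proxObj] using moreau_le_proxObj hL hμ y y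

lemma le_moreau {h : E → ℝ} {C : ℝ≥0} (hL : LipschitzWith C h) {μ : ℝ} (hμ : 0 < μ)
    (y : E) : h y - μ / 2 * (C : ℝ) ^ 2 ≤ moreau h μ y :=
  le_ciInf (proxObj_ge_of_lipschitz hL hμ y)

variable [InnerProductSpace ℝ E]

/-- The Moreau envelope at `u + μ w` grows at least like its linearization with slope `w`, up to
the curvature `2 W`. -/
lemma moreau_growth {h : E → ℝ} {W μ : ℝ} (hμ : 0 < μ) (hW0 : 0 ≤ W) (hμW : 2 * μ * W ≤ 1)
    {u w : E} (hw : IsWeakSubgrad h W u w) (y : E) :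
    h u + μ / 2 * ‖w‖ ^ 2 + inner ℝ w (y - (u + μ • w)) - W * ‖y - (u + μ • w)‖ ^ 2
      ≤ moreau h μ y := by
  refine le_ciInf fun z => ?_
  have h1 := hw z
  set s := y - (u + μ • w) with hs
  set a := z - u with ha
  have e1 : z - y = (a - s) - μ • w := by rw [hs, ha]; abel
  have e2 : ‖z - y‖ ^ 2 = ‖a - s‖ ^ 2 - 2 * μ * (inner ℝ w a - inner ℝ w s) + μ ^ 2 * ‖w‖ ^ 2 := by
    rw [e1, norm_sub_sq_real, inner_smul_right, norm_smul, Real.norm_of_nonneg hμ.le,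
      real_inner_comm, inner_sub_right]
    ring
  have e3 : 1 / (2 * μ) * ‖z - y‖ ^ 2
      = 1 / (2 * μ) * ‖a - s‖ ^ 2 - (inner ℝ w a - inner ℝ w s) + μ / 2 * ‖w‖ ^ 2 := by
    rw [e2]; field_simp
  have h2 : ‖a‖ ^ 2 ≤ 2 * ‖a - s‖ ^ 2 + 2 * ‖s‖ ^ 2 := by
    have h3 : ‖a‖ ≤ ‖a - s‖ + ‖s‖ := by simpa using norm_add_le (a - s) s
    nlinarith [norm_nonneg a, sq_nonneg (‖a - s‖ - ‖s‖)]
  have h4 : W * ‖a - s‖ ^ 2 ≤ 1 / (2 * μ) * ‖a - s‖ ^ 2 := by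
    gcongr
    rw [le_div_iff₀ (by positivity)]; linarith
  have h5 := mul_le_mul_of_nonneg_left h2 (by positivity : 0 ≤ W / 2)
  unfold proxObj
  rw [e3]
  linarith

/-- If `w` is a weak subgradient at `u`, then `u` is the proximal point of `u + μ w`. -/
lemma moreau_add_smul {h : E → ℝ} {C : ℝ≥0} (hL : LipschitzWith C h) {W μ : ℝ} (hμ : 0 < μ)
    (hW0 : 0 ≤ W) (hμW : 2 * μ * W ≤ 1) {u w : E} (hw : IsWeakSubgrad h W u w) :
    moreau h μ (u + μ • w) = h u + μ / 2 * ‖w‖ ^ 2 := by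
  apply le_antisymm
  · have := moreau_le_proxObj hL hμ (u + μ • w) u
    refine this.trans (le_of_eq ?_)
    unfold proxObj
    rw [sub_add_cancel_left, norm_neg, norm_smul, Real.norm_of_nonneg hμ.le]
    field_simp
  · simpa using moreau_growth hμ hW0 hμW hw (u + μ • w)

/-- Decreasing the smoothing parameter raises the Moreau envelope in a controlled way. -/
lemma moreau_param_le {h : E → ℝ} {C : ℝ≥0} (hL : LipschitzWith C h) {W μ ν : ℝ} (hμ : 0 < μ)
    (hν : 0 < ν) (hW0 : 0 ≤ W) (hμW : 2 * μ * W ≤ 1) {u w : E} (hw : IsWeakSubgrad h W u w) :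
    moreau h ν (u + μ • w) ≤ moreau h μ (u + μ • w) + (μ / ν - 1) * (μ / 2) * ‖w‖ ^ 2 := by
  refine (moreau_le_proxObj hL hν (u + μ • w) u).trans (le_of_eq ?_)
  rw [moreau_add_smul hL hμ hW0 hμW hw]
  unfold proxObj
  rw [sub_add_cancel_left, norm_neg, norm_smul, Real.norm_of_nonneg hμ.le]
  field_simp
  ring

/-- The gradients of two Moreau envelopes, compared through monotonicity of `∂h + W id`. -/
lemma norm_sub_le_of_isWeakSubgrad {h : E → ℝ} {W μ ν : ℝ} (hμ : 0 < μ)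
    (hμW : 2 * μ * W ≤ 1) {u w u' w' : E} (hw : IsWeakSubgrad h W u w)
    (hw' : IsWeakSubgrad h W u' w') :
    μ * ‖w - w'‖ ≤ ‖(u + μ • w) - (u' + ν • w')‖ + |ν - μ| * ‖w'‖ := by
  have h1 := hw u'
  have h2 := hw' u
  rw [norm_sub_rev, ← neg_sub u u', inner_neg_right] at h1
  have hmono : -W * ‖u - u'‖ ^ 2 ≤ inner ℝ (w - w') (u - u') := by
    rw [inner_sub_left]; linarith
  have h3 : μ * ‖w - w'‖ ≤ ‖(u - u') + μ • (w - w')‖ := by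
    apply le_of_sq_le_sq _ (norm_nonneg _)
    rw [norm_add_sq_real, inner_smul_right, norm_smul, Real.norm_of_nonneg hμ.le, real_inner_comm]
    have h4 := mul_le_mul_of_nonneg_left hmono (by positivity : 0 ≤ 2 * μ)
    nlinarith [mul_nonneg (sub_nonneg.mpr hμW) (sq_nonneg ‖u - u'‖)]
  refine h3.trans ?_
  have e : (u - u') + μ • (w - w') = ((u + μ • w) - (u' + ν • w')) + (ν - μ) • w' := by module
  rw [e]
  refine (norm_add_le _ _).trans ?_
  rw [norm_smul, Real.norm_eq_abs]

/-- The joint structure of the two proximal problems: if `u` solves the proximal problem with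
parameter `μ + 1/β` at `b`, the minimizer of `h_μ + β/2 ‖· - b‖²` is `u + μ w` with
`w = (b - u) / (μ + 1/β)`. -/
lemma eq_of_isMinOn_moreau {h : E → ℝ} {C : ℝ≥0} (hL : LipschitzWith C h) {W μ β : ℝ}
    (hμ : 0 < μ) (hβ : 0 < β) (hW0 : 0 ≤ W) (hμW : 2 * μ * W ≤ 1) (hWβ : 2 * W < β)
    {b u w y : E} (hb : b = u + (μ + 1 / β) • w) (hw : IsWeakSubgrad h W u w)
    (hy : IsMinOn (fun y => moreau h μ y + β / 2 * ‖y - b‖ ^ 2) univ y) :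
    y = u + μ • w := by
  have hg := moreau_growth hμ hW0 hμW hw y
  have hm : moreau h μ y + β / 2 * ‖y - b‖ ^ 2
      ≤ moreau h μ (u + μ • w) + β / 2 * ‖(u + μ • w) - b‖ ^ 2 := hy (mem_univ _)
  rw [moreau_add_smul hL hμ hW0 hμW hw] at hm
  set s := y - (u + μ • w) with hs
  have e1 : y - b = s - (1 / β) • w := by rw [hs, hb]; module
  have e2 : (u + μ • w) - b = -((1 / β) • w) := by rw [hb]; module
  rw [e1, e2, norm_neg, norm_sub_sq_real, inner_smul_right, real_inner_comm] at hm
  have e3 : β / 2 * (‖s‖ ^ 2 - 2 * (1 / β * inner ℝ w s) + ‖(1 / β) • w‖ ^ 2)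
      = β / 2 * ‖s‖ ^ 2 - inner ℝ w s + β / 2 * ‖(1 / β) • w‖ ^ 2 := by field_simp
  have h0 : (β / 2 - W) * ‖s‖ ^ 2 ≤ 0 := by linarith
  have h1 : ‖s‖ ^ 2 ≤ 0 := by
    by_contra! hc
    have : 0 < (β / 2 - W) * ‖s‖ ^ 2 := mul_pos (by linarith) hc
    linarith
  have h2 : s = 0 := by
    rw [← norm_eq_zero]; exact pow_eq_zero_iff (two_ne_zero) |>.mp (le_antisymm h1 (sq_nonneg _))
  exact sub_eq_zero.mp h2

end Moreau

/-! ### Smoothness, gradients of the Lagrangian, and the penalty sequence -/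

section Smooth

variable {E : Type*} [NormedAddCommGroup E] [InnerProductSpace ℝ E] [CompleteSpace E]

/-- The descent lemma for a function with Lipschitz gradient. -/
lemma le_add_of_lipschitz_gradient {F : E → ℝ} {G : E → E} {L : ℝ≥0}
    (hF : ∀ x, HasGradientAt F (G x) x) (hG : LipschitzWith L G) (x y : E) :
    F y ≤ F x + inner ℝ (G x) (y - x) + L / 2 * ‖y - x‖ ^ 2 := by
  set d := y - x with hd
  set φ : ℝ → ℝ := fun t => F (x + t • d) - t * inner ℝ (G x) d - L / 2 * t ^ 2 * ‖d‖ ^ 2 with hφ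
  have hder : ∀ t : ℝ, HasDerivAt φ
      (inner ℝ (G (x + t • d)) d - inner ℝ (G x) d - L * t * ‖d‖ ^ 2) t := by
    intro t
    have h1 : HasDerivAt (fun t : ℝ => x + t • d) d t := by
      simpa using ((hasDerivAt_id t).smul_const d).const_add x
    have h2 : HasDerivAt (fun t : ℝ => F (x + t • d)) (inner ℝ (G (x + t • d)) d) t := by
      have := (hF (x + t • d)).hasFDerivAt.comp_hasDerivAt t h1
      simpa [Function.comp_def] using this
    have h3 : HasDerivAt (fun t : ℝ => t * inner ℝ (G x) d) (inner ℝ (G x) d) t := by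
      simpa using (hasDerivAt_id t).mul_const (inner ℝ (G x) d)
    have h4 : HasDerivAt (fun t : ℝ => L / 2 * t ^ 2 * ‖d‖ ^ 2) (L * t * ‖d‖ ^ 2) t := by
      have := (((hasDerivAt_pow 2 t).const_mul ((L : ℝ) / 2)).mul_const (‖d‖ ^ 2))
      refine this.congr_deriv ?_
      push_cast; ring
    exact (h2.sub h3).sub h4
  have hanti : AntitoneOn φ (Icc 0 1) := by
    apply antitoneOn_of_deriv_nonpos (convex_Icc 0 1)
    · exact fun t _ => (hder t).continuousAt.continuousWithinAt
    · exact fun t _ => (hder t).differentiableAt.differentiableWithinAt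
    · intro t ht
      rw [interior_Icc] at ht
      rw [(hder t).deriv, ← inner_sub_left]
      have h5 := real_inner_le_norm (G (x + t • d) - G x) d
      have h6 := hG.dist_le_mul (x + t • d) x
      rw [dist_eq_norm, dist_eq_norm, add_sub_cancel_left, norm_smul,
        Real.norm_of_nonneg ht.1.le] at h6
      nlinarith [norm_nonneg d]
  have h := hanti (left_mem_Icc.mpr zero_le_one) (right_mem_Icc.mpr zero_le_one) zero_le_one
  simp only [hφ, zero_smul, one_smul, add_zero, hd, add_sub_cancel] at h
  linarith

lemma ge_sub_of_lipschitz_gradient {F : E → ℝ} {G : E → E} {L : ℝ≥0}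
    (hF : ∀ x, HasGradientAt F (G x) x) (hG : LipschitzWith L G) (x y : E) :
    F x + inner ℝ (G x) (y - x) - L / 2 * ‖y - x‖ ^ 2 ≤ F y := by
  have hF' : ∀ x, HasGradientAt (fun x => -F x) (-G x) x := fun x => by
    rw [hasGradientAt_iff_hasFDerivAt, map_neg]
    exact (hF x).hasFDerivAt.neg
  have h := le_add_of_lipschitz_gradient hF' hG.neg x y
  rw [inner_neg_left] at h
  linarith

/-- The gradient of `x ↦ ⟪z, B x - y⟫ + β/2 ‖B x - y‖²`. -/
lemma hasGradientAt_penalty {F : Type*} [NormedAddCommGroup F] [InnerProductSpace ℝ F]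
    [CompleteSpace F] (B : E →L[ℝ] F) (y z : F) (β : ℝ) (x : E) :
    HasGradientAt (fun x => inner ℝ z (B x - y) + β / 2 * ‖B x - y‖ ^ 2)
      (ContinuousLinearMap.adjoint B (z + β • (B x - y))) x := by
  rw [hasGradientAt_iff_hasFDerivAt]
  have h0 : HasFDerivAt (fun x => B x - y) B x := B.hasFDerivAt.sub_const y
  have h1 : HasFDerivAt (fun x => inner ℝ z (B x - y)) ((innerSL ℝ z).comp B) x :=
    (innerSL ℝ z).hasFDerivAt.comp x h0
  have h2 := (h0.norm_sq).const_mul (β / 2)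
  refine (h1.add h2).congr_fderiv ?_
  ext v
  simp [ContinuousLinearMap.adjoint_inner_left]
  ring

end Smooth

namespace Problem

variable {n r m : ℕ} {D : Problem n r m}

lemma Assumptions.hasGradientAt_f (hD : D.Assumptions) (X : MatSp n r) :
    HasGradientAt D.f (∇ D.f X) X := (hD.f_differentiable X).hasGradientAt

lemma gradient_S_left (hD : D.Assumptions) (X : MatSp n r) (y z : Vec m) (β : ℝ) :
    ∇ (fun X => D.S X y z β) X = ∇ D.f X + D.adj (z + β • (D.A X - y)) := by
  refine HasGradientAt.gradient ?_
  have h1 := (hD.hasGradientAt_f X).hasFDerivAt.add (hasGradientAt_penalty D.A y z β X).hasFDerivAt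
  rw [hasGradientAt_iff_hasFDerivAt, map_add]
  refine h1.congr_of_eventuallyEq (Eventually.of_forall fun X' => ?_)
  simp only [S, Pi.add_apply]
  ring

lemma gradient_S_right (X : MatSp n r) (y z : Vec m) (β : ℝ) :
    ∇ (fun y => D.S X y z β) y = -(z + β • (D.A X - y)) := by
  refine HasGradientAt.gradient ?_
  have h1 := (hasGradientAt_penalty (-ContinuousLinearMap.id ℝ (Vec m)) (-D.A X) z β y)
  have e : ContinuousLinearMap.adjoint (-ContinuousLinearMap.id ℝ (Vec m)) =
      -ContinuousLinearMap.id ℝ (Vec m) := by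
    rw [map_neg]; congr 1; exact ContinuousLinearMap.adjoint_id
  rw [e] at h1
  have e2 : ∀ y : Vec m, (-ContinuousLinearMap.id ℝ (Vec m)) y - -D.A X = D.A X - y := fun y => by
    simp; abel
  simp only [e2] at h1
  have h2 := h1.hasFDerivAt.const_add (D.f X)
  rw [hasGradientAt_iff_hasFDerivAt]
  refine (h2.congr_of_eventuallyEq (Eventually.of_forall fun y' => ?_)).congr_fderiv ?_
  · simp only [S]; ring
  · simp

end Problem

namespace Params

variable {P : Params} {W : ℝ}

lemma β_zero (hP : P.Admissible W) : P.β 0 = P.β₀ := by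
  simp [β, Real.zero_rpow hP.p_pos.ne']

lemma β_mono (hP : P.Admissible W) : Monotone P.β := by
  intro s t hst
  have := hP.p_pos; have := hP.β₀_pos; have := hP.ξ_pos
  unfold β
  gcongr

lemma β₀_le (hP : P.Admissible W) (t : ℕ) : P.β₀ ≤ P.β t := by
  rw [← β_zero hP]; exact β_mono hP (Nat.zero_le t)

lemma β_pos (hP : P.Admissible W) (t : ℕ) : 0 < P.β t := hP.β₀_pos.trans_le (β₀_le hP t)

lemma τ_pos (hP : P.Admissible W) : 0 < P.τ := by
  have := hP.σ_lt_two
  exact (by apply div_pos <;> linarith : 0 < 4 / (2 - P.σ)).trans_le hP.le_τ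

lemma μ_pos (hP : P.Admissible W) (t : ℕ) : 0 < P.μ t := div_pos (τ_pos hP) (β_pos hP t)

lemma β_succ_le (hP : P.Admissible W) (t : ℕ) : P.β (t + 1) ≤ (1 + P.ξ) * P.β t := by
  have h0 := hP.p_pos; have h1 := hP.β₀_pos; have h2 := hP.ξ_pos
  have h3 : ((t : ℝ) + 1) ^ P.p ≤ (t : ℝ) ^ P.p + 1 := by
    simpa using Real.rpow_add_le_add_rpow (Nat.cast_nonneg t) zero_le_one h0.le hP.p_lt_one.le
  have h4 : 0 ≤ (t : ℝ) ^ P.p := by positivity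
  unfold β
  push_cast
  have h5 : 1 + P.ξ * ((t : ℝ) + 1) ^ P.p ≤ (1 + P.ξ) * (1 + P.ξ * (t : ℝ) ^ P.p) := by
    nlinarith [mul_le_mul_of_nonneg_left h3 h2.le, mul_nonneg (mul_nonneg h2.le h2.le) h4]
  nlinarith [mul_le_mul_of_nonneg_left h5 h1.le]

lemma β_succ_le_two (hP : P.Admissible W) (t : ℕ) : P.β (t + 1) ≤ 2 * P.β t := by
  have := β_succ_le hP t
  nlinarith [β_pos hP t, hP.ξ_le_one]

lemma two_mul_W_le (hP : P.Admissible W) (t : ℕ) : 2 * P.τ * W ≤ P.β t :=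
  hP.le_β₀.trans (β₀_le hP t)

lemma two_mul_μ_mul_W_le (hP : P.Admissible W) (t : ℕ) : 2 * P.μ t * W ≤ 1 := by
  have := β_pos hP t
  rw [μ, show 2 * (P.τ / P.β t) * W = (2 * P.τ * W) / P.β t by ring, div_le_one this]
  exact two_mul_W_le hP t

lemma four_le_τ (hP : P.Admissible W) : 4 ≤ P.τ := by
  have h1 := hP.σ_lt_two; have h2 := hP.one_le_σ
  refine le_trans ?_ hP.le_τ
  rw [le_div_iff₀ (by linarith)]; linarith

lemma eight_mul_W_le (hP : P.Admissible W) (hW : 0 ≤ W) (t : ℕ) : 8 * W ≤ P.β t := by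
  nlinarith [two_mul_W_le hP t, four_le_τ hP]

lemma β_le (hP : P.Admissible W) {t : ℕ} (ht : 1 ≤ t) :
    P.β (t + 1) ≤ 3 * P.β₀ * (t : ℝ) ^ P.p := by
  have h0 := hP.p_pos; have h1 := hP.β₀_pos; have h2 := hP.ξ_pos
  have h3 : ((t : ℝ) + 1) ^ P.p ≤ (t : ℝ) ^ P.p + 1 := by
    simpa using Real.rpow_add_le_add_rpow (Nat.cast_nonneg t) zero_le_one h0.le hP.p_lt_one.le
  have h4 : 1 ≤ (t : ℝ) ^ P.p := Real.one_le_rpow (by exact_mod_cast ht) h0.le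
  have h5 : P.ξ * ((t : ℝ) + 1) ^ P.p ≤ 1 * ((t : ℝ) + 1) ^ P.p := by
    gcongr; exact hP.ξ_le_one
  unfold β
  push_cast
  have h6 : 1 + P.ξ * ((t : ℝ) + 1) ^ P.p ≤ 3 * (t : ℝ) ^ P.p := by linarith
  nlinarith [mul_le_mul_of_nonneg_left h6 h1.le]

lemma inv_β_le (hP : P.Admissible W) {t : ℕ} (ht : 1 ≤ t) :
    1 / P.β t ≤ 1 / (P.β₀ * P.ξ) * (t : ℝ) ^ (-P.p) := by
  have h1 := hP.β₀_pos; have h2 := hP.ξ_pos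
  have h4 : 0 < (t : ℝ) ^ P.p := by positivity
  rw [Real.rpow_neg (by positivity), ← one_div, one_div_mul_one_div]
  unfold β
  exact one_div_le_one_div_of_le (by positivity) (by nlinarith)

end Params

/-- Comparison of `∑ t^{-p}` with `∫ t^{-p}`. -/
lemma sum_rpow_neg_le {p : ℝ} (hp0 : 0 < p) (hp1 : p < 1) (T : ℕ) :
    ∑ t ∈ Finset.Icc 1 T, (t : ℝ) ^ (-p) ≤ 1 / (1 - p) * (T : ℝ) ^ (1 - p) := by
  have hq : 0 < 1 - p := by linarith
  induction T with
  | zero => simp [Real.zero_rpow hq.ne']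
  | succ T ih =>
    rw [Finset.sum_Icc_succ_top (by omega)]
    have hT : (0 : ℝ) < (T : ℝ) + 1 := by positivity
    have h1 := rpow_one_add_le_one_add_mul_self (s := -(1 / ((T : ℝ) + 1))) (by
      rw [neg_le_neg_iff, div_le_one hT]; linarith [(Nat.cast_nonneg T : (0 : ℝ) ≤ T)])
      hq.le (by linarith : 1 - p ≤ 1)
    have h2 : (T : ℝ) = ((T : ℝ) + 1) * (1 + -(1 / ((T : ℝ) + 1))) := by field_simp; ring
    have h3 : (T : ℝ) ^ (1 - p) ≤ ((T : ℝ) + 1) ^ (1 - p) - (1 - p) * ((T : ℝ) + 1) ^ (-p) := by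
      have h4 : ((T : ℝ) + 1) ^ (-p) = ((T : ℝ) + 1) ^ (1 - p) * (1 / ((T : ℝ) + 1)) := by
        rw [show -p = (1 - p) - 1 by ring, Real.rpow_sub_one hT.ne']; ring
      have h5 : 0 ≤ 1 + -(1 / ((T : ℝ) + 1)) := by
        rw [← sub_eq_add_neg, sub_nonneg, div_le_one hT]
        linarith [(Nat.cast_nonneg T : (0 : ℝ) ≤ T)]
      calc (T : ℝ) ^ (1 - p) = ((T : ℝ) + 1) ^ (1 - p) * (1 + -(1 / ((T : ℝ) + 1))) ^ (1 - p) := by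
            rw [← Real.mul_rpow hT.le h5, ← h2]
        _ ≤ ((T : ℝ) + 1) ^ (1 - p) * (1 + (1 - p) * -(1 / ((T : ℝ) + 1))) := by gcongr
        _ = _ := by rw [h4]; ring
    have h6 := mul_le_mul_of_nonneg_left h3 (by positivity : 0 ≤ 1 / (1 - p))
    have h7 : 1 / (1 - p) * ((1 - p) * ((T : ℝ) + 1) ^ (-p)) = ((T : ℝ) + 1) ^ (-p) := by
      field_simp
    push_cast
    linarith

/-! ### The dual recursion -/

/-- The arithmetic behind the control of the dual increments `c` (new) and `a` (old): the recursion
is averaged by convexity, and `τ ≥ 4 / (2 - σ)` bounds the coefficient of the primal increment. -/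
lemma dual_increment_le {σ τ b β a c ω y C : ℝ} (hσ1 : 1 ≤ σ) (hσ2 : σ < 2)
    (hτ : 4 / (2 - σ) ≤ τ) (hb : 0 < b) (hbβ : b ≤ β) (hβb : β ≤ 2 * b) (hc0 : 0 ≤ c)
    (hω0 : 0 ≤ ω) (hc : c ≤ (σ - 1) * a + σ * ω)
    (hω : ω ≤ β / τ * y + (β / b - 1) * C) :
    3 / 2 * (1 / (σ * β)) * c ^ 2 ≤ 3 / 2 * ((σ - 1) / ((2 - σ) * σ)) / β * (a ^ 2 - c ^ 2)
      + 3 * β / 8 * y ^ 2 + 3 * σ * C ^ 2 / (2 - σ) ^ 2 * (1 / b - 1 / β) := by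
  have hs : 0 < 2 - σ := by linarith
  have hσ : 0 < σ := by linarith
  have hβ : 0 < β := by linarith
  have hτ0 : 0 < τ := lt_of_lt_of_le (by positivity) hτ
  have h1 : (2 - σ) * c ^ 2 ≤ (2 - σ) * (σ - 1) * a ^ 2 + σ ^ 2 * ω ^ 2 := by
    have h2 : c ^ 2 ≤ ((σ - 1) * a + σ * ω) ^ 2 := by gcongr
    have h3 : 0 ≤ (σ - 1) * ((2 - σ) * a - σ * ω) ^ 2 :=
      mul_nonneg (by linarith) (sq_nonneg _)
    have h4 := mul_le_mul_of_nonneg_left h2 hs.le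
    linarith
  have h5 : 1 / (σ * β) * c ^ 2
      ≤ (σ - 1) / ((2 - σ) * σ) / β * (a ^ 2 - c ^ 2) + σ / ((2 - σ) ^ 2 * β) * ω ^ 2 := by
    have h6 := mul_le_mul_of_nonneg_left h1
      (by positivity : 0 ≤ 1 / ((2 - σ) ^ 2 * σ * β))
    have e1 : 1 / ((2 - σ) ^ 2 * σ * β) * ((2 - σ) * c ^ 2)
        = 1 / (σ * β) * c ^ 2 + (σ - 1) / ((2 - σ) * σ) / β * c ^ 2 := by
      field_simp; ring
    have e2 : 1 / ((2 - σ) ^ 2 * σ * β) * ((2 - σ) * (σ - 1) * a ^ 2 + σ ^ 2 * ω ^ 2)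
        = (σ - 1) / ((2 - σ) * σ) / β * a ^ 2 + σ / ((2 - σ) ^ 2 * β) * ω ^ 2 := by
      field_simp
    rw [e1, e2] at h6
    linarith
  have h7 : ω ^ 2 ≤ 2 * (β / τ * y) ^ 2 + 2 * ((β / b - 1) * C) ^ 2 := by
    have : ω ^ 2 ≤ (β / τ * y + (β / b - 1) * C) ^ 2 := by gcongr
    nlinarith [sq_nonneg (β / τ * y - (β / b - 1) * C)]
  have h8 : σ / ((2 - σ) ^ 2 * β) * (2 * (β / τ * y) ^ 2) ≤ β / 4 * y ^ 2 := by
    have h9 : 4 ≤ τ * (2 - σ) := by rwa [div_le_iff₀ hs] at hτ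
    have h10 : 16 ≤ (τ * (2 - σ)) ^ 2 := by nlinarith
    have e : σ / ((2 - σ) ^ 2 * β) * (2 * (β / τ * y) ^ 2)
        = 2 * σ / (τ * (2 - σ)) ^ 2 * (β * y ^ 2) := by field_simp
    have h11 : 2 * σ / (τ * (2 - σ)) ^ 2 ≤ 1 / 4 := by
      rw [div_le_iff₀ (by positivity)]; linarith
    rw [e]
    calc _ ≤ 1 / 4 * (β * y ^ 2) := by gcongr
      _ = _ := by ring
  have h12 : σ / ((2 - σ) ^ 2 * β) * (2 * ((β / b - 1) * C) ^ 2)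
      ≤ 2 * σ * C ^ 2 / (2 - σ) ^ 2 * (1 / b - 1 / β) := by
    have h13 : 1 / β * (β / b - 1) ^ 2 ≤ 1 / b - 1 / β := by
      have e : 1 / b - 1 / β = 1 / β * (β / b - 1) := by field_simp
      rw [e]
      have h14 : 0 ≤ β / b - 1 := by rw [sub_nonneg, le_div_iff₀ hb]; linarith
      have h15 : β / b - 1 ≤ 1 := by rw [sub_le_iff_le_add, div_le_iff₀ hb]; linarith
      gcongr
      nlinarith
    have e : σ / ((2 - σ) ^ 2 * β) * (2 * ((β / b - 1) * C) ^ 2)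
        = 2 * σ * C ^ 2 / (2 - σ) ^ 2 * (1 / β * (β / b - 1) ^ 2) := by field_simp
    rw [e]
    gcongr
  have h16 := mul_le_mul_of_nonneg_left h7 (by positivity : 0 ≤ σ / ((2 - σ) ^ 2 * β))
  have e3 : 3 / 2 * ((σ - 1) / ((2 - σ) * σ)) / β * (a ^ 2 - c ^ 2)
      = 3 / 2 * ((σ - 1) / ((2 - σ) * σ) / β * (a ^ 2 - c ^ 2)) := by ring
  have e4 : 3 * σ * C ^ 2 / (2 - σ) ^ 2 * (1 / b - 1 / β)
      = 3 / 2 * (2 * σ * C ^ 2 / (2 - σ) ^ 2 * (1 / b - 1 / β)) := by ring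
  rw [e3, e4]
  linarith

/-- The model decrease at an exact minimizer over the Stiefel manifold, expressed through the
projected model gradient at the old point `X`. Completing the square at `X` turns the model into
the one of `IsStiefelDescentConst`. -/
lemma model_decrease {n r : ℕ} {κ : ℝ} (hκ : IsStiefelDescentConst r κ)
    {X Xc G X' : MatSp n r} {c ρ : ℝ} (hX : X ∈ stiefel n r) (hc : 0 ≤ c) (hρ : 0 < ρ)
    (hle : ‖G + c • (X - Xc)‖ + c ≤ ρ)
    (hmin : IsMinOn (fun Y => inner ℝ (Y - X) G + c / 2 * ‖Y - Xc‖ ^ 2) (stiefel n r) X') :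
    inner ℝ (X' - X) G + c / 2 * ‖X' - Xc‖ ^ 2
      ≤ c / 2 * ‖X - Xc‖ ^ 2 - κ / ρ * ‖projTangent X (G + c • (X - Xc))‖ ^ 2 := by
  obtain ⟨Y, hY, h1⟩ := hκ n X _ c ρ hX hc hρ hle
  have h2 : inner ℝ (X' - X) G + c / 2 * ‖X' - Xc‖ ^ 2
      ≤ inner ℝ (Y - X) G + c / 2 * ‖Y - Xc‖ ^ 2 := hmin hY
  have e : ‖Y - Xc‖ ^ 2 = ‖Y - X‖ ^ 2 + 2 * inner ℝ (Y - X) (X - Xc) + ‖X - Xc‖ ^ 2 := by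
    rw [← norm_add_sq_real, sub_add_sub_cancel]
  rw [inner_add_right, inner_smul_right] at h1
  rw [e] at h2
  linarith

namespace Problem

variable {n r m : ℕ} {D : Problem n r m}

lemma ell_nonneg {β : ℝ} (hβ : 0 ≤ β) : 0 ≤ D.ell β := by unfold ell; positivity

lemma penalty_expand (X Xc : MatSp n r) (y z : Vec m) (β : ℝ) :
    inner ℝ z (D.A X - y) + β / 2 * ‖D.A X - y‖ ^ 2
      = inner ℝ z (D.A Xc - y) + β / 2 * ‖D.A Xc - y‖ ^ 2
        + inner ℝ (D.adj (z + β • (D.A Xc - y))) (X - Xc) + β / 2 * ‖D.A (X - Xc)‖ ^ 2 := by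
  have e : D.A X - y = (D.A Xc - y) + D.A (X - Xc) := by rw [map_sub]; abel
  rw [adj, ContinuousLinearMap.adjoint_inner_left, e, norm_add_sq_real, inner_add_right,
    inner_add_left, inner_smul_left]
  simp only [conj_trivial]
  ring

/-- Smoothness of the augmented Lagrangian in `X`, with the gradient taken at a third point. -/
lemma S_sub_le (hD : D.Assumptions) {β : ℝ} (hβ : 0 ≤ β) (X X' Xc : MatSp n r) (y z : Vec m) :
    D.S X' y z β - D.S X y z β ≤ inner ℝ (X' - X) (∇ (fun X => D.S X y z β) Xc)
      + D.ell β / 2 * ‖X' - Xc‖ ^ 2 + D.ell β / 2 * ‖X - Xc‖ ^ 2 := by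
  have h1 := le_add_of_lipschitz_gradient hD.hasGradientAt_f hD.f_smooth Xc X'
  have h2 := ge_sub_of_lipschitz_gradient hD.hasGradientAt_f hD.f_smooth Xc X
  have h3 := D.penalty_expand X' Xc y z β
  have h4 := D.penalty_expand X Xc y z β
  have h5 : ‖D.A (X' - Xc)‖ ^ 2 ≤ ‖D.A‖ ^ 2 * ‖X' - Xc‖ ^ 2 := by
    rw [← mul_pow]; gcongr; exact D.A.le_opNorm _
  have h6 := mul_le_mul_of_nonneg_left h5 (by positivity : 0 ≤ β / 2)
  have h7 : 0 ≤ β / 2 * ‖D.A (X - Xc)‖ ^ 2 := by positivity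
  have h8 : 0 ≤ β / 2 * ‖D.A‖ ^ 2 * ‖X - Xc‖ ^ 2 := by positivity
  rw [gradient_S_left hD, real_inner_comm, inner_add_left,
    show X' - X = (X' - Xc) - (X - Xc) by abel,
    inner_sub_right _ (X' - Xc), inner_sub_right _ (X' - Xc)]
  unfold S ell
  linarith

end Problem

namespace Iterates

variable {n r m : ℕ} {D : Problem n r m} {P : Params} {R : Iterates n r m}

/-- The multiplier `z^t + (z^{t+1} - z^t) / σ`, which is the gradient of the Moreau envelope at
`y^{t+1}` and a subgradient of `h` at `y̆^{t+1}`. -/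
def w (P : Params) (R : Iterates n r m) (t : ℕ) : Vec m :=
  R.z t + (1 / P.σ) • (R.z (t + 1) - R.z t)

lemma z_succ (hP : P.Admissible D.Wh) (t : ℕ) :
    R.z (t + 1) = (1 - P.σ) • R.z t + P.σ • R.w P t := by
  have : P.σ ≠ 0 := by linarith [hP.one_le_σ]
  unfold w
  rw [smul_add, smul_smul, mul_one_div_cancel this]
  module

lemma b_eq (hP : P.Admissible D.Wh) (t : ℕ) :
    R.b D P t = D.A (R.X (t + 1)) + (1 / P.β t) • R.z t := by
  have := (Params.β_pos hP t).ne'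
  rw [b, Problem.gradient_S_right, smul_neg, smul_add, smul_smul, one_div_mul_cancel this]
  module

namespace IsRunEP

lemma mem_stiefel (hR : R.IsRunEP D P) (t : ℕ) : R.X (t + 1) ∈ stiefel n r := by
  obtain ⟨v, -, h, -⟩ := hR.X_step t
  exact h

lemma residual_eq (hP : P.Admissible D.Wh) (hR : R.IsRunEP D P) (t : ℕ) :
    D.A (R.X (t + 1)) - R.y (t + 1) = (1 / (P.σ * P.β t)) • (R.z (t + 1) - R.z t) := by
  have h1 : P.σ * P.β t ≠ 0 :=
    mul_ne_zero (by linarith [hP.one_le_σ]) (Params.β_pos hP t).ne'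
  rw [hR.z_step t, add_sub_cancel_left, smul_smul, one_div_mul_cancel h1, one_smul]

lemma y_eq_and_mem (hD : D.Assumptions) (hP : P.Admissible D.Wh) (hR : R.IsRunEP D P) (t : ℕ) :
    R.y (t + 1) = R.yb (t + 1) + P.μ t • R.w P t ∧
      R.w P t ∈ frechetSubdiff D.h (R.yb (t + 1)) := by
  have hβ := Params.β_pos hP t
  have hμ := Params.μ_pos hP t
  have hν : 0 < P.μ t + 1 / P.β t := by positivity
  set w' : Vec m := (1 / (P.μ t + 1 / P.β t)) • (R.b D P t - R.yb (t + 1)) with hw'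
  have hmem : w' ∈ frechetSubdiff D.h (R.yb (t + 1)) :=
    mem_frechetSubdiff_of_isMinOn_proxObj hν (hR.yb_step t)
  have hb : R.b D P t = R.yb (t + 1) + (P.μ t + 1 / P.β t) • w' := by
    rw [hw', smul_smul, mul_one_div_cancel hν.ne', one_smul, add_sub_cancel]
  have hWβ : 2 * (D.Wh : ℝ) < P.β t := by
    have := Params.eight_mul_W_le hP D.Wh.coe_nonneg t
    nlinarith [D.Wh.coe_nonneg]
  have hy := eq_of_isMinOn_moreau hD.h_lipschitz hμ hβ D.Wh.coe_nonneg (Params.two_mul_μ_mul_W_le hP t) hWβ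
    hb (isWeakSubgrad_of_mem_frechetSubdiff hD.h_weakly_convex hmem D.Wh.coe_nonneg) (hR.y_step t)
  have hw : R.w P t = w' := by
    have h1 : R.b D P t - R.y (t + 1) = (1 / P.β t) • w' := by rw [hb, hy]; module
    have h2 := residual_eq hP hR t
    rw [b_eq hP] at h1
    have hσ : P.σ ≠ 0 := by linarith [hP.one_le_σ]
    have h3 : w' = P.β t • ((1 / P.β t) • w') := by
      rw [smul_smul, mul_one_div_cancel hβ.ne', one_smul]
    rw [h3, ← h1, add_sub_right_comm, h2, w, smul_add, smul_smul, smul_smul,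
      mul_one_div_cancel hβ.ne', one_smul, add_comm]
    congr 2
    field_simp
  exact ⟨hw ▸ hy, hw ▸ hmem⟩

lemma isWeakSubgrad_w (hD : D.Assumptions) (hP : P.Admissible D.Wh) (hR : R.IsRunEP D P) (t : ℕ) :
    IsWeakSubgrad D.h D.Wh (R.yb (t + 1)) (R.w P t) :=
  isWeakSubgrad_of_mem_frechetSubdiff hD.h_weakly_convex (y_eq_and_mem hD hP hR t).2 D.Wh.coe_nonneg

lemma norm_w_le (hD : D.Assumptions) (hP : P.Admissible D.Wh) (hR : R.IsRunEP D P) (t : ℕ) :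
    ‖R.w P t‖ ≤ D.Ch :=
  norm_le_of_mem_frechetSubdiff hD.h_lipschitz (y_eq_and_mem hD hP hR t).2

/-- The multipliers stay bounded: `z^{t+1}` is a combination of `z^t` with weight `1 - σ`,
`|1 - σ| < 1`, and of a bounded subgradient. -/
lemma norm_z_le (hD : D.Assumptions) (hP : P.Admissible D.Wh) (hR : R.IsRunEP D P) (t : ℕ) :
    ‖R.z t‖ ≤ max ‖R.z 0‖ (P.σ * D.Ch / (2 - P.σ)) := by
  have h1 := hP.one_le_σ
  have h2 : 0 < 2 - P.σ := by linarith [hP.σ_lt_two]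
  set B := max ‖R.z 0‖ (P.σ * D.Ch / (2 - P.σ)) with hB
  induction t with
  | zero => exact le_max_left _ _
  | succ t ih =>
    have h3 : P.σ * D.Ch ≤ B * (2 - P.σ) := by
      rw [← div_le_iff₀ h2]; exact le_max_right _ _
    rw [z_succ hP]
    refine (norm_add_le _ _).trans ?_
    rw [norm_smul, norm_smul, Real.norm_of_nonpos (by linarith), Real.norm_of_nonneg (by linarith)]
    have h4 := mul_le_mul_of_nonneg_left ih (by linarith : 0 ≤ P.σ - 1)
    have h5 := mul_le_mul_of_nonneg_left (norm_w_le hD hP hR t) (by linarith : 0 ≤ P.σ)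
    linarith

lemma norm_dX_le (hR : R.IsRunEP D P) (t : ℕ) :
    ‖R.X (t + 1) - R.X t‖ ≤ 2 * √(r : ℝ) + ‖R.X 0‖ := by
  refine (norm_sub_le _ _).trans ?_
  rw [norm_of_mem_stiefel (mem_stiefel hR t)]
  rcases t with _ | t
  · linarith [Real.sqrt_nonneg (r : ℝ)]
  · rw [norm_of_mem_stiefel (mem_stiefel hR t)]
    linarith [norm_nonneg (R.X 0)]

lemma norm_dw_le (hD : D.Assumptions) (hP : P.Admissible D.Wh) (hR : R.IsRunEP D P) (t : ℕ) :
    ‖R.w P (t + 1) - R.w P t‖ ≤ P.β (t + 1) / P.τ * ‖R.y (t + 2) - R.y (t + 1)‖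
      + (P.β (t + 1) / P.β t - 1) * D.Ch := by
  have hβ := Params.β_pos hP t
  have hβ' := Params.β_pos hP (t + 1)
  have hτ := Params.τ_pos hP
  have hμ := Params.μ_pos hP (t + 1)
  have h1 := norm_sub_le_of_isWeakSubgrad (ν := P.μ t) hμ (Params.two_mul_μ_mul_W_le hP (t + 1))
    (isWeakSubgrad_w hD hP hR (t + 1)) (isWeakSubgrad_w hD hP hR t)
  rw [← (y_eq_and_mem hD hP hR (t + 1)).1, ← (y_eq_and_mem hD hP hR t).1] at h1
  have hle : P.β t ≤ P.β (t + 1) := Params.β_mono hP (Nat.le_succ t)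
  have h2 : 0 ≤ P.μ t - P.μ (t + 1) := by
    rw [sub_nonneg]; unfold Params.μ; gcongr
  rw [abs_of_nonneg h2] at h1
  have h3 := mul_le_mul_of_nonneg_left (norm_w_le hD hP hR t) h2
  have h4 := mul_le_mul_of_nonneg_left (h1.trans (add_le_add_right h3 _))
    (by positivity : 0 ≤ P.β (t + 1) / P.τ)
  have e1 : P.β (t + 1) / P.τ * P.μ (t + 1) = 1 := by unfold Params.μ; field_simp
  have e2 : P.β (t + 1) / P.τ * (P.μ t - P.μ (t + 1)) = P.β (t + 1) / P.β t - 1 := by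
    rw [mul_sub, e1]; unfold Params.μ; field_simp
  rw [← mul_assoc, e1, one_mul, mul_add, ← mul_assoc, e2] at h4
  exact h4

lemma dual_step (hD : D.Assumptions) (hP : P.Admissible D.Wh) (hR : R.IsRunEP D P) (t : ℕ) :
    3 / 2 * (1 / (P.σ * P.β (t + 1))) * ‖R.z (t + 2) - R.z (t + 1)‖ ^ 2
      ≤ 3 / 2 * ((P.σ - 1) / ((2 - P.σ) * P.σ)) / P.β (t + 1)
          * (‖R.z (t + 1) - R.z t‖ ^ 2 - ‖R.z (t + 2) - R.z (t + 1)‖ ^ 2)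
        + 3 * P.β (t + 1) / 8 * ‖R.y (t + 2) - R.y (t + 1)‖ ^ 2
        + 3 * P.σ * (D.Ch : ℝ) ^ 2 / (2 - P.σ) ^ 2 * (1 / P.β t - 1 / P.β (t + 1)) := by
  refine dual_increment_le hP.one_le_σ hP.σ_lt_two hP.le_τ (Params.β_pos hP t)
    (Params.β_mono hP (Nat.le_succ t)) (Params.β_succ_le_two hP t) (norm_nonneg _)
    (norm_nonneg (R.w P (t + 1) - R.w P t)) ?_ (norm_dw_le hD hP hR t)
  have e : R.z (t + 2) - R.z (t + 1)
      = (1 - P.σ) • (R.z (t + 1) - R.z t) + P.σ • (R.w P (t + 1) - R.w P t) := by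
    rw [z_succ hP (t + 1)]
    nth_rewrite 2 [z_succ hP t]
    module
  have h1 := hP.one_le_σ
  rw [e]
  refine (norm_add_le _ _).trans (le_of_eq ?_)
  rw [norm_smul, norm_smul, Real.norm_of_nonpos (by linarith), Real.norm_of_nonneg (by linarith)]
  ring

end IsRunEP

end Iterates

/-! ### One-step changes of the augmented Lagrangian -/

namespace Iterates

variable {n r m : ℕ} {D : Problem n r m} {P : Params} {R : Iterates n r m}

/-- The smoothed augmented Lagrangian at the `t`-th iterate. -/
def lagr (D : Problem n r m) (P : Params) (R : Iterates n r m) (t : ℕ) : ℝ :=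
  D.S (R.X t) (R.y t) (R.z t) (P.β t) - D.g (R.X t) + moreau D.h (P.μ t) (R.y t)

/-- The gradient of the proximal-gradient model at `X^t` when the subgradient `v` is used. -/
def modelGrad (D : Problem n r m) (P : Params) (R : Iterates n r m) (t : ℕ) (v : MatSp n r) :
    MatSp n r :=
  R.gradX D P t - v + (P.θ * D.ell (P.β t)) • (R.X t - R.Xc P t)

/-- The gradient that enters the criticality measure at `X^t`. -/
def critGrad (D : Problem n r m) (R : Iterates n r m) (t : ℕ) (v : MatSp n r) : MatSp n r :=
  ∇ D.f (R.X t) - v + D.adj (R.z t)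

lemma Xc_succ (t : ℕ) : R.Xc P (t + 1) = R.X (t + 1) + P.α • (R.X (t + 1) - R.X t) := rfl

lemma α_lt_one {W : ℝ} (hP : P.Admissible W) : P.α < 1 := by
  have h1 := hP.one_lt_θ; have h2 := hP.ξ_pos
  refine hP.α_lt.trans ?_
  rw [div_lt_one (by nlinarith)]
  nlinarith

namespace IsRunEP

lemma modelGrad_sub_critGrad_le (hD : D.Assumptions) (hP : P.Admissible D.Wh)
    (hR : R.IsRunEP D P) (t : ℕ) (v : MatSp n r) :
    ‖R.modelGrad D P (t + 1) v - R.critGrad D (t + 1) v‖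
      ≤ (1 + P.θ) * (D.ell (P.β (t + 1)) * ‖R.X (t + 1) - R.X t‖)
        + 2 * ‖D.A‖ * ‖R.z (t + 1) - R.z t‖ := by
  set β := P.β (t + 1) with hβ
  have hβ0 : 0 < β := Params.β_pos hP _
  set d := R.X (t + 1) - R.X t with hd
  have hα := α_lt_one hP
  have hα0 := hP.α_nonneg
  have hθ := hP.one_lt_θ
  have hXc : R.Xc P (t + 1) - R.X (t + 1) = P.α • d := by rw [Xc_succ]; abel
  have hell : 0 ≤ D.ell β := Problem.ell_nonneg hβ0.le
  have e : R.modelGrad D P (t + 1) v - R.critGrad D (t + 1) v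
      = (∇ D.f (R.Xc P (t + 1)) - ∇ D.f (R.X (t + 1))) + β • D.adj (D.A (P.α • d))
        + β • D.adj (D.A (R.X (t + 1)) - R.y (t + 1)) - (P.θ * D.ell β) • (P.α • d) := by
    have e1 : D.adj (R.z (t + 1) + β • (D.A (R.Xc P (t + 1)) - R.y (t + 1)))
        = D.adj (R.z (t + 1)) + (β • D.adj (D.A (P.α • d))
          + β • D.adj (D.A (R.X (t + 1)) - R.y (t + 1))) := by
      rw [← hXc, map_add, map_smul, ← smul_add, ← map_add, map_sub D.A, sub_add_sub_cancel]
    rw [modelGrad, critGrad, gradX, Problem.gradient_S_left hD, ← hβ, e1, ← hXc]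
    module
  have hadj : ‖D.adj‖ = ‖D.A‖ := LinearIsometryEquiv.norm_map _ _
  have hαd : ‖P.α • d‖ ≤ ‖d‖ := by
    rw [norm_smul, Real.norm_of_nonneg hα0]
    nlinarith [norm_nonneg d]
  have h1 : ‖∇ D.f (R.Xc P (t + 1)) - ∇ D.f (R.X (t + 1))‖ ≤ D.Lf * ‖d‖ := by
    have := hD.f_smooth.dist_le_mul (R.Xc P (t + 1)) (R.X (t + 1))
    rw [dist_eq_norm, dist_eq_norm, hXc] at this
    exact this.trans (by gcongr)
  have h2 : ‖β • D.adj (D.A (P.α • d))‖ ≤ β * (‖D.A‖ * (‖D.A‖ * ‖d‖)) := by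
    rw [norm_smul, Real.norm_of_nonneg hβ0.le]
    gcongr
    refine (D.adj.le_opNorm _).trans ?_
    rw [hadj]
    gcongr
    exact (D.A.le_opNorm _).trans (by gcongr)
  have h3 : ‖β • D.adj (D.A (R.X (t + 1)) - R.y (t + 1))‖
      ≤ 2 * ‖D.A‖ * ‖R.z (t + 1) - R.z t‖ := by
    have hb := Params.β_pos hP t
    have hσ := hP.one_le_σ
    rw [residual_eq hP hR, map_smul, smul_smul, norm_smul, Real.norm_of_nonneg (by positivity)]
    have h4 : β * (1 / (P.σ * P.β t)) ≤ 2 := by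
      rw [mul_one_div, div_le_iff₀ (by positivity)]
      have := Params.β_succ_le_two hP t
      nlinarith
    have h5 := D.adj.le_opNorm (R.z (t + 1) - R.z t)
    rw [hadj] at h5
    exact (mul_le_mul h4 h5 (norm_nonneg _) zero_le_two).trans_eq (by ring)
  have h4 : ‖(P.θ * D.ell β) • (P.α • d)‖ ≤ P.θ * D.ell β * ‖d‖ := by
    rw [norm_smul, Real.norm_of_nonneg (by positivity)]
    gcongr
  rw [e]
  refine (norm_sub_le _ _).trans ?_
  have h5 := norm_add_le ((∇ D.f (R.Xc P (t + 1)) - ∇ D.f (R.X (t + 1)))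
    + β • D.adj (D.A (P.α • d))) (β • D.adj (D.A (R.X (t + 1)) - R.y (t + 1)))
  have h6 := norm_add_le (∇ D.f (R.Xc P (t + 1)) - ∇ D.f (R.X (t + 1)))
    (β • D.adj (D.A (P.α • d)))
  have e2 : (1 + P.θ) * (D.ell β * ‖d‖)
      = D.Lf * ‖d‖ + β * (‖D.A‖ * (‖D.A‖ * ‖d‖)) + P.θ * D.ell β * ‖d‖ := by
    unfold Problem.ell; ring
  rw [e2]
  linarith

/-- Decrease of the augmented Lagrangian in the primal block `X`. The extrapolation turns
`(θ - 1)/2 ‖X^{t+2} - X_c‖²` into `(1 - α)` times the new squared increment, at the price of a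
multiple of the old one. -/
lemma X_decrease {κ : ℝ} (hκ : IsStiefelDescentConst r κ)
    (hD : D.Assumptions) (hP : P.Admissible D.Wh) (hR : R.IsRunEP D P) (t : ℕ) {ρ : ℝ}
    (hρ : 0 < ρ) (hle : ∀ v ∈ subdiff D.g (R.X (t + 1)),
      ‖R.modelGrad D P (t + 1) v‖ + P.θ * D.ell (P.β (t + 1)) ≤ ρ) :
    ∃ v ∈ subdiff D.g (R.X (t + 1)),
      D.S (R.X (t + 2)) (R.y (t + 1)) (R.z (t + 1)) (P.β (t + 1)) - D.g (R.X (t + 2))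
        ≤ D.S (R.X (t + 1)) (R.y (t + 1)) (R.z (t + 1)) (P.β (t + 1)) - D.g (R.X (t + 1))
          - (P.θ - 1) / 2 * (1 - P.α) * (D.ell (P.β (t + 1)) * ‖R.X (t + 2) - R.X (t + 1)‖ ^ 2)
          + ((P.θ - 1) * P.α + 2 * P.α ^ 2) / 2
            * (D.ell (P.β (t + 1)) * ‖R.X (t + 1) - R.X t‖ ^ 2)
          - κ / ρ * ‖projTangent (R.X (t + 1)) (R.modelGrad D P (t + 1) v)‖ ^ 2 := by
  have hθ := hP.one_lt_θ
  have hβ0 := Params.β_pos hP (t + 1)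
  have hell : 0 ≤ D.ell (P.β (t + 1)) := Problem.ell_nonneg hβ0.le
  obtain ⟨v, hv, -, hmin⟩ := hR.X_step (t + 1)
  refine ⟨v, hv, ?_⟩
  have h1 := model_decrease hκ (mem_stiefel hR t) (by positivity) hρ (hle v hv) hmin
  have h2 := Problem.S_sub_le hD hβ0.le (R.X (t + 1)) (R.X (t + 2)) (R.Xc P (t + 1)) (R.y (t + 1))
    (R.z (t + 1))
  have h3 := le_of_mem_subdiff hD.g_convex hv (R.X (t + 2))
  have e1 : inner ℝ (R.X (t + 2) - R.X (t + 1)) (R.gradX D P (t + 1) - v)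
      = inner ℝ (R.X (t + 2) - R.X (t + 1)) (R.gradX D P (t + 1))
        - inner ℝ v (R.X (t + 2) - R.X (t + 1)) := by
    rw [inner_sub_right, real_inner_comm v]
  rw [show t + 1 + 1 = t + 2 from rfl, e1] at h1
  set a := R.X (t + 2) - R.X (t + 1) with ha
  set d := R.X (t + 1) - R.X t with hd
  have hα0 := hP.α_nonneg
  have e2 : ‖R.X (t + 1) - R.Xc P (t + 1)‖ ^ 2 = P.α ^ 2 * ‖d‖ ^ 2 := by
    rw [Xc_succ, sub_add_cancel_left, norm_neg, norm_smul, Real.norm_of_nonneg hα0, mul_pow]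
  -- Young's inequality for `‖a - α d‖²`.
  have h4 : (1 - P.α) * ‖a‖ ^ 2 - (P.α - P.α ^ 2) * ‖d‖ ^ 2
      ≤ ‖R.X (t + 2) - R.Xc P (t + 1)‖ ^ 2 := by
    have e3 : R.X (t + 2) - R.Xc P (t + 1) = a - P.α • d := by rw [Xc_succ, ha, hd]; abel
    rw [e3, norm_sub_sq_real a, inner_smul_right, norm_smul, Real.norm_of_nonneg hα0]
    have h5 := real_inner_le_norm a d
    have h6 : inner ℝ a d ≤ (‖a‖ ^ 2 + ‖d‖ ^ 2) / 2 := by nlinarith [sq_nonneg (‖a‖ - ‖d‖)]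
    nlinarith [mul_le_mul_of_nonneg_left h6 hα0]
  have h7 := mul_le_mul_of_nonneg_left h4
    (mul_nonneg (by linarith : 0 ≤ (P.θ - 1) / 2) hell)
  rw [e2] at h1 h2
  change _ ≤ _ - κ / ρ * ‖projTangent (R.X (t + 1)) (R.modelGrad D P (t + 1) v)‖ ^ 2 at h1
  change _ ≤ inner ℝ a (R.gradX D P (t + 1)) + _ + _ at h2
  linarith

/-- Decrease of the augmented Lagrangian in the block `y`. -/
lemma y_decrease (hD : D.Assumptions) (hP : P.Admissible D.Wh) (hR : R.IsRunEP D P) (t : ℕ) :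
    D.S (R.X (t + 1)) (R.y (t + 1)) (R.z t) (P.β t) + moreau D.h (P.μ t) (R.y (t + 1))
      ≤ D.S (R.X (t + 1)) (R.y t) (R.z t) (P.β t) + moreau D.h (P.μ t) (R.y t)
        - 3 * P.β t / 8 * ‖R.y (t + 1) - R.y t‖ ^ 2 := by
  have hβ := Params.β_pos hP t
  have hσ := hP.one_le_σ
  obtain ⟨hy, -⟩ := y_eq_and_mem hD hP hR t
  have hμ := Params.μ_pos hP t
  have hμW := Params.two_mul_μ_mul_W_le hP t
  have hw := isWeakSubgrad_w hD hP hR t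
  have h1 := moreau_growth hμ D.Wh.coe_nonneg hμW hw (R.y t)
  have h2 := moreau_add_smul hD.h_lipschitz hμ D.Wh.coe_nonneg hμW hw
  rw [← hy] at h1 h2
  set q := D.A (R.X (t + 1)) - R.y (t + 1) with hq
  set s := R.y t - R.y (t + 1) with hs
  -- The slope `w` of the envelope cancels the linear terms of the penalty.
  have hwq : R.w P t = R.z t + P.β t • q := by
    rw [hq, residual_eq hP hR, w, smul_smul]
    congr 2
    field_simp
  have e : D.A (R.X (t + 1)) - R.y t = q - s := by rw [hq, hs]; abel
  rw [norm_sub_rev (R.y (t + 1))]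
  unfold Problem.S
  rw [e, ← hq, ← hs, norm_sub_sq_real q, inner_sub_right _ q, h2]
  rw [hwq, inner_add_left, inner_smul_left, ← hwq] at h1
  simp only [conj_trivial] at h1
  have h8 := Params.eight_mul_W_le hP D.Wh.coe_nonneg t
  have h9 : (D.Wh : ℝ) * ‖s‖ ^ 2 ≤ P.β t / 8 * ‖s‖ ^ 2 := by
    gcongr; linarith
  linarith

/-- Increase of the augmented Lagrangian by the multiplier update. -/
lemma z_increase (hP : P.Admissible D.Wh) (hR : R.IsRunEP D P) (t : ℕ) :
    D.S (R.X (t + 1)) (R.y (t + 1)) (R.z (t + 1)) (P.β t)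
      = D.S (R.X (t + 1)) (R.y (t + 1)) (R.z t) (P.β t)
        + 1 / (P.σ * P.β t) * ‖R.z (t + 1) - R.z t‖ ^ 2 := by
  unfold Problem.S
  have h1 : inner ℝ (R.z (t + 1) - R.z t) (D.A (R.X (t + 1)) - R.y (t + 1))
      = 1 / (P.σ * P.β t) * ‖R.z (t + 1) - R.z t‖ ^ 2 := by
    rw [residual_eq hP hR, inner_smul_right, real_inner_self_eq_norm_sq]
  rw [inner_sub_left] at h1
  linarith

/-- Increase of the augmented Lagrangian by the update of the penalty and the smoothing
parameters, which is summable. -/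
lemma param_increase (hD : D.Assumptions) (hP : P.Admissible D.Wh) (hR : R.IsRunEP D P) (t : ℕ) :
    D.S (R.X (t + 1)) (R.y (t + 1)) (R.z (t + 1)) (P.β (t + 1))
        + moreau D.h (P.μ (t + 1)) (R.y (t + 1))
      ≤ D.S (R.X (t + 1)) (R.y (t + 1)) (R.z (t + 1)) (P.β t) + moreau D.h (P.μ t) (R.y (t + 1))
        + (‖R.z (t + 1) - R.z t‖ ^ 2 + P.τ * (D.Ch : ℝ) ^ 2) * (1 / P.β t - 1 / P.β (t + 1)) := by
  have hb := Params.β_pos hP t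
  have hβ := Params.β_pos hP (t + 1)
  have hbβ : P.β t ≤ P.β (t + 1) := Params.β_mono hP (Nat.le_succ t)
  have h2b := Params.β_succ_le_two hP t
  have hσ := hP.one_le_σ
  have hτ := Params.τ_pos hP
  obtain ⟨hy, -⟩ := y_eq_and_mem hD hP hR t
  have h1 := moreau_param_le hD.h_lipschitz (Params.μ_pos hP t) (Params.μ_pos hP (t + 1)) D.Wh.coe_nonneg
    (Params.two_mul_μ_mul_W_le hP t) (isWeakSubgrad_w hD hP hR t)
  rw [← hy] at h1
  have hδ : (P.β (t + 1) - P.β t) / (2 * P.β t ^ 2) ≤ 1 / P.β t - 1 / P.β (t + 1) := by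
    have e : 1 / P.β t - 1 / P.β (t + 1) = (P.β (t + 1) - P.β t) / (P.β t * P.β (t + 1)) := by
      field_simp
    rw [e]
    apply div_le_div_of_nonneg_left (by linarith) (by positivity)
    nlinarith
  have hδ0 : 0 ≤ (P.β (t + 1) - P.β t) / (2 * P.β t ^ 2) :=
    div_nonneg (by linarith) (by positivity)
  have h2 : (P.μ t / P.μ (t + 1) - 1) * (P.μ t / 2) * ‖R.w P t‖ ^ 2
      ≤ P.τ * (D.Ch : ℝ) ^ 2 * (1 / P.β t - 1 / P.β (t + 1)) := by
    have e : (P.μ t / P.μ (t + 1) - 1) * (P.μ t / 2) * ‖R.w P t‖ ^ 2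
        = P.τ * ‖R.w P t‖ ^ 2 * ((P.β (t + 1) - P.β t) / (2 * P.β t ^ 2)) := by
      unfold Params.μ; field_simp
    rw [e]
    have := norm_w_le hD hP hR t
    gcongr
  have h3 : (P.β (t + 1) - P.β t) / 2 * ‖D.A (R.X (t + 1)) - R.y (t + 1)‖ ^ 2
      ≤ ‖R.z (t + 1) - R.z t‖ ^ 2 * (1 / P.β t - 1 / P.β (t + 1)) := by
    rw [residual_eq hP hR, norm_smul, Real.norm_of_nonneg (by positivity), mul_pow]
    have e : (P.β (t + 1) - P.β t) / 2 *
        ((1 / (P.σ * P.β t)) ^ 2 * ‖R.z (t + 1) - R.z t‖ ^ 2)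
        = ‖R.z (t + 1) - R.z t‖ ^ 2 * ((P.β (t + 1) - P.β t) / (2 * P.β t ^ 2)) * (1 / P.σ ^ 2) := by
      field_simp
    rw [e]
    have h4 : 1 / P.σ ^ 2 ≤ 1 := by
      rw [div_le_one (by positivity)]; exact one_le_pow₀ hσ
    refine (mul_le_of_le_one_right (by positivity) h4).trans ?_
    gcongr
  unfold Problem.S
  linarith

end IsRunEP

end Iterates

/-! ### The potential function -/

namespace Params

/-- The weight of the squared dual increment in the potential function. -/
def dualWeight (P : Params) : ℝ := 3 / 2 * ((P.σ - 1) / ((2 - P.σ) * P.σ)) + 1 / (2 * P.σ)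

/-- The weight of the squared primal increment in the potential function. It is chosen so that,
multiplied by the growth factor `1 + ξ` of the penalty, it equals the decrease
`(θ - 1) (1 - α) / 2` of the primal step. -/
def primalWeight (P : Params) : ℝ := (P.θ - 1) / 2 * (1 - P.α) / (1 + P.ξ)

/-- The part of `primalWeight` that the extrapolation does not consume. -/
def primalGain (P : Params) : ℝ := P.primalWeight - ((P.θ - 1) * P.α + 2 * P.α ^ 2) / 2

variable {P : Params} {W : ℝ}

lemma dualWeight_nonneg (hP : P.Admissible W) : 0 ≤ P.dualWeight := by
  have h1 := hP.one_le_σ; have h2 := hP.σ_lt_two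
  have : 0 ≤ (P.σ - 1) / ((2 - P.σ) * P.σ) :=
    div_nonneg (by linarith) (mul_nonneg (by linarith) (by linarith))
  unfold dualWeight
  positivity

lemma primalGain_pos (hP : P.Admissible W) : 0 < P.primalGain := by
  have h1 := hP.one_lt_θ; have h2 := hP.ξ_pos; have h3 := hP.α_nonneg
  have h4 := hP.α_lt
  have h5 : P.α < 1 := Iterates.α_lt_one hP
  rw [lt_div_iff₀ (by nlinarith)] at h4
  unfold primalGain primalWeight
  rw [sub_pos, lt_div_iff₀ (by linarith)]
  nlinarith [mul_nonneg h3 h2.le, mul_nonneg h3 (sub_nonneg.mpr h5.le),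
    mul_nonneg (mul_nonneg h3 h2.le) (sub_nonneg.mpr h5.le)]

lemma primalWeight_nonneg (hP : P.Admissible W) : 0 ≤ P.primalWeight := by
  have h1 := hP.one_lt_θ; have h2 := hP.ξ_pos; have h5 : P.α < 1 := Iterates.α_lt_one hP
  exact div_nonneg (mul_nonneg (by linarith) (by linarith)) (by linarith)

end Params

namespace Problem

variable {n r m : ℕ} {D : Problem n r m} {P : Params}

lemma ell_succ_le (hP : P.Admissible D.Wh) (t : ℕ) :
    D.ell (P.β (t + 1)) ≤ (1 + P.ξ) * D.ell (P.β t) := by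
  have h1 := mul_le_mul_of_nonneg_right (Params.β_succ_le hP t) (sq_nonneg ‖D.A‖)
  have h2 : 0 ≤ P.ξ * (D.Lf : ℝ) := mul_nonneg hP.ξ_pos.le D.Lf.coe_nonneg
  unfold ell
  linarith

lemma ell_le (hP : P.Admissible D.Wh) (t : ℕ) :
    D.ell (P.β t) ≤ (‖D.A‖ ^ 2 + D.Lf / P.β₀) * P.β t := by
  have h0 := hP.β₀_pos
  have h1 : (D.Lf : ℝ) ≤ D.Lf / P.β₀ * P.β t := by
    rw [div_mul_eq_mul_div, le_div_iff₀ h0]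
    exact mul_le_mul_of_nonneg_left (Params.β₀_le hP t) D.Lf.coe_nonneg
  unfold ell
  linarith

end Problem

namespace Iterates

variable {n r m : ℕ} {D : Problem n r m} {P : Params} {R : Iterates n r m}

/-- The potential function. The last two terms absorb the summable errors of the parameter
updates; `B` is a bound of the dual increments. -/
def energy (D : Problem n r m) (P : Params) (R : Iterates n r m) (B : ℝ) (t : ℕ) : ℝ :=
  R.lagr D P (t + 1) + P.dualWeight / P.β (t + 1) * ‖R.z (t + 1) - R.z t‖ ^ 2
    + P.primalWeight * (D.ell (P.β (t + 1)) * ‖R.X (t + 1) - R.X t‖ ^ 2)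
    + 3 * P.σ * (D.Ch : ℝ) ^ 2 / (2 - P.σ) ^ 2 * (1 / P.β t)
    + (B ^ 2 + P.τ * (D.Ch : ℝ) ^ 2) * (1 / P.β (t + 1))

namespace IsRunEP

/-- The potential decreases by a multiple of everything that the criticality measure needs. -/
lemma energy_step {κ : ℝ} (hκ : IsStiefelDescentConst r κ)
    (hD : D.Assumptions) (hP : P.Admissible D.Wh) (hR : R.IsRunEP D P) {B : ℝ}
    (hB : ∀ t, ‖R.z (t + 1) - R.z t‖ ≤ B) (t : ℕ) {ρ : ℝ}
    (hρ : 0 < ρ) (hle : ∀ v ∈ subdiff D.g (R.X (t + 1)),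
      ‖R.modelGrad D P (t + 1) v‖ + P.θ * D.ell (P.β (t + 1)) ≤ ρ) :
    ∃ v ∈ subdiff D.g (R.X (t + 1)),
      R.energy D P B (t + 1)
          + (κ / ρ * ‖projTangent (R.X (t + 1)) (R.modelGrad D P (t + 1) v)‖ ^ 2
          + P.primalGain * (D.ell (P.β (t + 1)) * ‖R.X (t + 1) - R.X t‖ ^ 2)
          + 1 / (2 * P.σ * P.β (t + 1)) * ‖R.z (t + 1) - R.z t‖ ^ 2)
        ≤ R.energy D P B t := by
  obtain ⟨v, hv, h1⟩ := X_decrease hκ hD hP hR t hρ hle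
  refine ⟨v, hv, ?_⟩
  have h2 := y_decrease hD hP hR (t + 1)
  have h3 := z_increase hP hR (t + 1)
  have h4 := param_increase hD hP hR (t + 1)
  have h5 := dual_step hD hP hR t
  have hb := Params.β_pos hP (t + 1)
  have hb' := Params.β_pos hP (t + 2)
  have hbb : P.β (t + 1) ≤ P.β (t + 2) := Params.β_mono hP (Nat.le_succ _)
  have hσ := hP.one_le_σ
  have hξ := hP.ξ_pos
  simp only [show t + 1 + 1 = t + 2 from rfl] at h1 h2 h3 h4 h5
  have hδ : 0 ≤ 1 / P.β (t + 1) - 1 / P.β (t + 2) := by rw [sub_nonneg]; gcongr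
  have h6 : ‖R.z (t + 2) - R.z (t + 1)‖ ^ 2 ≤ B ^ 2 := by gcongr; exact hB (t + 1)
  have h7 := mul_le_mul_of_nonneg_right h6 hδ
  have h8 : P.dualWeight / P.β (t + 2) * ‖R.z (t + 2) - R.z (t + 1)‖ ^ 2
      ≤ P.dualWeight / P.β (t + 1) * ‖R.z (t + 2) - R.z (t + 1)‖ ^ 2 := by
    have := Params.dualWeight_nonneg hP
    gcongr
  have h9 : P.primalWeight * (D.ell (P.β (t + 2)) * ‖R.X (t + 2) - R.X (t + 1)‖ ^ 2)
      ≤ (P.θ - 1) / 2 * (1 - P.α)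
        * (D.ell (P.β (t + 1)) * ‖R.X (t + 2) - R.X (t + 1)‖ ^ 2) := by
    have h10 := Problem.ell_succ_le hP (t + 1)
    have h11 := Params.primalWeight_nonneg hP
    have e : (P.θ - 1) / 2 * (1 - P.α) = P.primalWeight * (1 + P.ξ) := by
      unfold Params.primalWeight; field_simp
    rw [e, mul_assoc, ← mul_assoc (1 + P.ξ)]
    gcongr
  have e1 : P.dualWeight / P.β (t + 1) = 3 / 2 * ((P.σ - 1) / ((2 - P.σ) * P.σ)) / P.β (t + 1)
      + 1 / (2 * P.σ * P.β (t + 1)) := by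
    unfold Params.dualWeight; rw [add_div, div_div]
  have e2 : 1 / (P.σ * P.β (t + 1)) = 2 * (1 / (2 * P.σ * P.β (t + 1))) := by field_simp
  rw [e1] at h8
  rw [e2] at h3 h5
  unfold energy lagr Params.primalGain
  simp only [show t + 1 + 1 = t + 2 from rfl]
  rw [e1]
  linarith

/-- The criticality measure at `(X^{t+1}, y̆^{t+1}, z^{t+1})` in terms of the quantities that the
potential function controls. -/
lemma crit_le (hD : D.Assumptions) (hP : P.Admissible D.Wh) (hR : R.IsRunEP D P) {B : ℝ}
    (hB : ∀ t, ‖R.z (t + 1) - R.z t‖ ≤ B) (t : ℕ) {v : MatSp n r}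
    (hv : v ∈ subdiff D.g (R.X (t + 1))) :
    D.crit (R.X (t + 1)) (R.yb (t + 1)) (R.z (t + 1))
      ≤ (B + P.τ * D.Ch) * (1 / P.β t)
        + (‖projTangent (R.X (t + 1)) (R.modelGrad D P (t + 1) v)‖
        + (1 + r) * (1 + P.θ) * (D.ell (P.β (t + 1)) * ‖R.X (t + 1) - R.X t‖)
        + ((1 + r) * (2 * ‖D.A‖) + 1) * ‖R.z (t + 1) - R.z t‖) := by
  have hb := Params.β_pos hP t
  have hσ := hP.one_le_σ
  have hτ := Params.τ_pos hP
  obtain ⟨hy, hw⟩ := y_eq_and_mem hD hP hR t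
  have h1 : ‖D.A (R.X (t + 1)) - R.yb (t + 1)‖ ≤ (B + P.τ * D.Ch) * (1 / P.β t) := by
    have e : D.A (R.X (t + 1)) - R.yb (t + 1)
        = (D.A (R.X (t + 1)) - R.y (t + 1)) + P.μ t • R.w P t := by rw [hy]; abel
    rw [e, add_mul]
    refine (norm_add_le _ _).trans (add_le_add ?_ ?_)
    · rw [residual_eq hP hR, norm_smul, Real.norm_of_nonneg (by positivity), mul_comm]
      have h2 : 1 / (P.σ * P.β t) ≤ 1 / P.β t :=
        one_div_le_one_div_of_le hb (by nlinarith)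
      exact mul_le_mul (hB t) h2 (by positivity) ((norm_nonneg _).trans (hB t))
    · rw [norm_smul, Real.norm_of_nonneg (Params.μ_pos hP t).le, Params.μ]
      have := norm_w_le hD hP hR t
      calc P.τ / P.β t * ‖R.w P t‖ ≤ P.τ / P.β t * D.Ch := by gcongr
        _ = _ := by ring
  have h2 : Metric.infDist (R.z (t + 1)) (subdiff D.h (R.yb (t + 1)))
      ≤ ‖R.z (t + 1) - R.z t‖ := by
    refine (Metric.infDist_le_dist_of_mem (frechetSubdiff_subset_subdiff _ _ hw)).trans ?_
    have e : R.z (t + 1) - R.w P t = (1 - 1 / P.σ) • (R.z (t + 1) - R.z t) := by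
      unfold w; module
    have h3 : 1 / P.σ ≤ 1 := by rw [div_le_one (by linarith)]; exact hσ
    have h4 : 0 < 1 / P.σ := by positivity
    rw [dist_eq_norm, e, norm_smul, Real.norm_of_nonneg (by linarith)]
    exact mul_le_of_le_one_left (norm_nonneg _) (by linarith)
  have h3 : Metric.infDist 0 ((fun v => projTangent (R.X (t + 1))
      (∇ D.f (R.X (t + 1)) - v + D.adj (R.z (t + 1)))) '' subdiff D.g (R.X (t + 1)))
      ≤ ‖projTangent (R.X (t + 1)) (R.critGrad D (t + 1) v)‖ := by
    refine (Metric.infDist_le_dist_of_mem (mem_image_of_mem _ hv)).trans_eq ?_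
    rw [dist_zero_left]; rfl
  have h4 : ‖projTangent (R.X (t + 1)) (R.critGrad D (t + 1) v)‖
      ≤ ‖projTangent (R.X (t + 1)) (R.modelGrad D P (t + 1) v)‖
        + (1 + r) * ((1 + P.θ) * (D.ell (P.β (t + 1)) * ‖R.X (t + 1) - R.X t‖)
          + 2 * ‖D.A‖ * ‖R.z (t + 1) - R.z t‖) := by
    have h5 := norm_projTangent_le (mem_stiefel hR t)
      (R.modelGrad D P (t + 1) v - R.critGrad D (t + 1) v)
    rw [← projTangent_sub] at h5
    have h6 := modelGrad_sub_critGrad_le hD hP hR t v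
    have h7 := mul_le_mul_of_nonneg_left h6 (by positivity : (0 : ℝ) ≤ 1 + r)
    have h8 := norm_sub_norm_le (projTangent (R.X (t + 1)) (R.critGrad D (t + 1) v))
      (projTangent (R.X (t + 1)) (R.modelGrad D P (t + 1) v))
    rw [norm_sub_rev] at h8
    linarith
  unfold Problem.crit
  linarith

/-- The model gradient grows at most like the penalty parameter. -/
lemma norm_modelGrad_le (hD : D.Assumptions) (hP : P.Admissible D.Wh) (hR : R.IsRunEP D P)
    {Bz Bd : ℝ} (hBz : ∀ t, ‖R.z t‖ ≤ Bz) (hBd : ∀ t, ‖R.X (t + 1) - R.X t‖ ≤ Bd) (t : ℕ)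
    {v : MatSp n r} (hv : v ∈ subdiff D.g (R.X (t + 1))) :
    ‖R.modelGrad D P (t + 1) v‖ + P.θ * D.ell (P.β (t + 1))
      ≤ ((D.Cf + D.Cg + 5 * ‖D.A‖ * Bz) / P.β₀
        + ((1 + P.θ) * Bd + P.θ) * (‖D.A‖ ^ 2 + D.Lf / P.β₀) + 1) * P.β (t + 1) := by
  have hθ := hP.one_lt_θ
  have h0 := hP.β₀_pos
  have hb := Params.β_pos hP (t + 1)
  have hBz0 : 0 ≤ Bz := (norm_nonneg _).trans (hBz 0)
  have hBd0 : 0 ≤ Bd := (norm_nonneg _).trans (hBd 0)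
  have hadj : ‖D.adj‖ = ‖D.A‖ := LinearIsometryEquiv.norm_map _ _
  have h1 : ‖R.critGrad D (t + 1) v‖ ≤ D.Cf + D.Cg + ‖D.A‖ * Bz := by
    refine (norm_add_le _ _).trans (add_le_add ((norm_sub_le _ _).trans (add_le_add ?_ ?_)) ?_)
    · exact hD.f_grad_bound _ (mem_stiefel hR t)
    · exact norm_le_of_mem_subdiff hD.g_convex hD.g_lipschitz hv
    · refine (D.adj.le_opNorm _).trans ?_
      rw [hadj]
      gcongr
      exact hBz _
  have h2 := modelGrad_sub_critGrad_le hD hP hR t v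
  have h3 := norm_sub_norm_le (R.modelGrad D P (t + 1) v) (R.critGrad D (t + 1) v)
  have hell := Problem.ell_nonneg (D := D) hb.le
  have h4 : (1 + P.θ) * (D.ell (P.β (t + 1)) * ‖R.X (t + 1) - R.X t‖)
      ≤ (1 + P.θ) * (D.ell (P.β (t + 1)) * Bd) := by
    gcongr; exact hBd t
  have h5 : 2 * ‖D.A‖ * ‖R.z (t + 1) - R.z t‖ ≤ 2 * ‖D.A‖ * (2 * Bz) := by
    gcongr
    linarith [norm_sub_le (R.z (t + 1)) (R.z t), hBz t, hBz (t + 1)]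
  have h6 := mul_le_mul_of_nonneg_left (Problem.ell_le hP (t + 1))
    (by positivity : 0 ≤ (1 + P.θ) * Bd + P.θ)
  have h7 : (D.Cf : ℝ) + D.Cg + 5 * ‖D.A‖ * Bz
      ≤ (D.Cf + D.Cg + 5 * ‖D.A‖ * Bz) / P.β₀ * P.β (t + 1) := by
    rw [div_mul_eq_mul_div, le_div_iff₀ h0]
    exact mul_le_mul_of_nonneg_left (Params.β₀_le hP (t + 1)) (by positivity)
  linarith

lemma norm_residual_le (hP : P.Admissible D.Wh) (hR : R.IsRunEP D P) {B : ℝ}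
    (hB : ∀ t, ‖R.z (t + 1) - R.z t‖ ≤ B) (t : ℕ) :
    ‖D.A (R.X (t + 1)) - R.y (t + 1)‖ ≤ B / P.β₀ := by
  have h0 := hP.β₀_pos
  have hb := Params.β_pos hP t
  have hσ := hP.one_le_σ
  rw [residual_eq hP hR, norm_smul, Real.norm_of_nonneg (by positivity), mul_comm, mul_one_div]
  have hB0 := (norm_nonneg _).trans (hB t)
  have h1 := Params.β₀_le hP t
  exact div_le_div₀ hB0 (hB t) h0 (by nlinarith)

lemma norm_y_le (hP : P.Admissible D.Wh) (hR : R.IsRunEP D P) {B : ℝ}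
    (hB : ∀ t, ‖R.z (t + 1) - R.z t‖ ≤ B) (t : ℕ) :
    ‖R.y (t + 1)‖ ≤ ‖D.A‖ * √(r : ℝ) + B / P.β₀ := by
  have h1 := norm_residual_le hP hR hB t
  have h2 := D.A.le_opNorm (R.X (t + 1))
  rw [norm_of_mem_stiefel (mem_stiefel hR t)] at h2
  have h3 := norm_sub_norm_le (R.y (t + 1)) (D.A (R.X (t + 1)))
  rw [norm_sub_rev] at h3
  linarith

end IsRunEP

/-- A continuous function on a finite-dimensional space is bounded on balls. -/
lemma exists_abs_le_of_norm_le {E : Type*} [NormedAddCommGroup E] [ProperSpace E] {F : E → ℝ}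
    (hF : Continuous F) (ρ : ℝ) : ∃ B : ℝ, 0 ≤ B ∧ ∀ x, ‖x‖ ≤ ρ → |F x| ≤ B := by
  obtain ⟨B, hB⟩ := (isCompact_closedBall (0 : E) ρ).exists_bound_of_continuousOn hF.continuousOn
  refine ⟨max B 0, le_max_right _ _, fun x hx => ?_⟩
  exact (hB x (mem_closedBall_zero_iff.mpr hx)).trans (le_max_left _ _)

/-- The potential function is bounded below along every run, and its initial value is bounded
above in terms of bounds of the multipliers and the primal increments. -/
lemma exists_energy_bound (hD : D.Assumptions) (hP : P.Admissible D.Wh) (Bz Bd : ℝ) :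
    ∃ V : ℝ, 0 ≤ V ∧ ∀ R : Iterates n r m, R.IsRunEP D P → (∀ t, ‖R.z t‖ ≤ Bz) →
      (∀ t, ‖R.X (t + 1) - R.X t‖ ≤ Bd) →
      R.energy D P (2 * Bz) 0 ≤ V ∧ ∀ t, -V ≤ R.energy D P (2 * Bz) t := by
  obtain ⟨Bf, hBf0, hBf⟩ := exists_abs_le_of_norm_le hD.f_differentiable.continuous √(r : ℝ)
  obtain ⟨Bg, hBg0, hBg⟩ := exists_abs_le_of_norm_le hD.g_lipschitz.continuous √(r : ℝ)
  obtain ⟨Bh, hBh0, hBh⟩ := exists_abs_le_of_norm_le hD.h_lipschitz.continuous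
    (‖D.A‖ * √(r : ℝ) + 2 * Bz / P.β₀)
  have h0 := hP.β₀_pos
  have hτ := Params.τ_pos hP
  have hσ := hP.one_le_σ
  have hσ2 := hP.σ_lt_two
  have hdw := Params.dualWeight_nonneg hP
  have hpw := Params.primalWeight_nonneg hP
  have hell := fun t => Problem.ell_nonneg (D := D) (Params.β_pos hP t).le
  have hb := Params.β_pos hP
  set Q := Bf + Bg + Bh + P.τ / P.β₀ / 2 * (D.Ch : ℝ) ^ 2 + |Bz * (2 * Bz / P.β₀)|
    + P.β 1 / 2 * (2 * Bz / P.β₀) ^ 2 with hQ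
  set U := P.dualWeight / P.β 1 * (2 * Bz) ^ 2 + P.primalWeight * (D.ell (P.β 1) * Bd ^ 2)
    + 3 * P.σ * (D.Ch : ℝ) ^ 2 / (2 - P.σ) ^ 2 * (1 / P.β 0)
    + ((2 * Bz) ^ 2 + P.τ * (D.Ch : ℝ) ^ 2) * (1 / P.β 1) with hU
  have hQ0 : 0 ≤ Q := by have := hb 1; positivity
  have hU0 : 0 ≤ U := by have := hb 1; have := hb 0; have := hell 1; positivity
  refine ⟨Q + U, by positivity, fun R hR hBz hBd => ?_⟩
  have hB : ∀ t, ‖R.z (t + 1) - R.z t‖ ≤ 2 * Bz := fun t => by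
    linarith [norm_sub_le (R.z (t + 1)) (R.z t), hBz t, hBz (t + 1)]
  have hX : ∀ t, ‖R.X (t + 1)‖ ≤ √(r : ℝ) := fun t =>
    (norm_of_mem_stiefel (IsRunEP.mem_stiefel hR t)).le
  have hf := fun t => abs_le.mp (hBf _ (hX t))
  have hg := fun t => abs_le.mp (hBg _ (hX t))
  have hh := fun t => abs_le.mp (hBh _ (IsRunEP.norm_y_le hP hR hB t))
  have hin : ∀ t, |inner ℝ (R.z (t + 1)) (D.A (R.X (t + 1)) - R.y (t + 1))|
      ≤ |Bz * (2 * Bz / P.β₀)| := fun t => by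
    refine (abs_real_inner_le_norm _ _).trans (le_trans ?_ (le_abs_self _))
    exact mul_le_mul (hBz _) (IsRunEP.norm_residual_le hP hR hB t) (norm_nonneg _)
      ((norm_nonneg _).trans (hBz 0))
  have hin' := fun t => abs_le.mp (hin t)
  have hβ1 := hb 1
  constructor
  · have h1 := moreau_le hD.h_lipschitz (Params.μ_pos hP 1) (R.y 1)
    have h2 : P.β 1 / 2 * ‖D.A (R.X 1) - R.y 1‖ ^ 2 ≤ P.β 1 / 2 * (2 * Bz / P.β₀) ^ 2 := by
      have := IsRunEP.norm_residual_le hP hR hB 0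
      gcongr
    have h3 : P.dualWeight / P.β 1 * ‖R.z 1 - R.z 0‖ ^ 2
        ≤ P.dualWeight / P.β 1 * (2 * Bz) ^ 2 := by
      have := hB 0
      gcongr
    have h4 : P.primalWeight * (D.ell (P.β 1) * ‖R.X 1 - R.X 0‖ ^ 2)
        ≤ P.primalWeight * (D.ell (P.β 1) * Bd ^ 2) := by
      have := hBd 0
      have := hell 1
      gcongr
    have h5 : 0 ≤ P.τ / P.β₀ / 2 * (D.Ch : ℝ) ^ 2 := by positivity
    have h6 := hf 0; have h7 := hg 0; have h8 := hh 0; have h9 := hin' 0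
    simp only [zero_add] at h6 h7 h8 h9
    unfold energy lagr Problem.S
    simp only [zero_add]
    linarith [h6.2, h7.1, h8.2, h9.2]
  · intro t
    have h1 := le_moreau hD.h_lipschitz (Params.μ_pos hP (t + 1)) (R.y (t + 1))
    have h2 : P.μ (t + 1) / 2 * (D.Ch : ℝ) ^ 2 ≤ P.τ / P.β₀ / 2 * (D.Ch : ℝ) ^ 2 := by
      have := Params.β₀_le hP (t + 1)
      unfold Params.μ
      gcongr
    have hb1 := hb (t + 1)
    have hb0 := hb t
    have hl1 := hell (t + 1)
    have h3 : 0 ≤ P.β (t + 1) / 2 * ‖D.A (R.X (t + 1)) - R.y (t + 1)‖ ^ 2 := by positivity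
    have h4 : 0 ≤ P.dualWeight / P.β (t + 1) * ‖R.z (t + 1) - R.z t‖ ^ 2 := by positivity
    have h5 : 0 ≤ P.primalWeight * (D.ell (P.β (t + 1)) * ‖R.X (t + 1) - R.X t‖ ^ 2) := by
      positivity
    have h6 : 0 ≤ 3 * P.σ * (D.Ch : ℝ) ^ 2 / (2 - P.σ) ^ 2 * (1 / P.β t) := by positivity
    have h7 : 0 ≤ ((2 * Bz) ^ 2 + P.τ * (D.Ch : ℝ) ^ 2) * (1 / P.β (t + 1)) := by positivity
    have h8 : 0 ≤ P.β 1 / 2 * (2 * Bz / P.β₀) ^ 2 := by positivity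
    unfold energy lagr Problem.S
    linarith [(hf t).1, (hg t).2, (hh t).1, (hin' t).1]

end Iterates

/-! ### Summation and rates -/

/-- Each of three terms is controlled, relative to `β`, by one part of the decrease. -/
lemma sq_sum_le_mul {κ M η σ β Λ l k₁ k₂ q d s : ℝ} (hκ : 0 < κ) (hM : 0 < M) (hη : 0 < η)
    (hβ : 0 < β) (hσ : 0 < σ) (hΛ : 0 ≤ Λ) (hl : 0 ≤ l) (hlΛ : l ≤ Λ * β) :
    (q + k₁ * (l * d) + k₂ * s) ^ 2 ≤ 3 * (M / κ + k₁ ^ 2 * Λ / η + 2 * σ * k₂ ^ 2) * β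
      * (κ / (M * β) * q ^ 2 + η * (l * d ^ 2) + 1 / (2 * σ * β) * s ^ 2) := by
  have p1 : 0 ≤ κ / (M * β) * q ^ 2 := by positivity
  have p2 : 0 ≤ η * (l * d ^ 2) := by positivity
  have p3 : 0 ≤ 1 / (2 * σ * β) * s ^ 2 := by positivity
  have e1 : q ^ 2 = M / κ * β * (κ / (M * β) * q ^ 2) := by field_simp
  have e2 : k₁ ^ 2 * Λ / η * β * (η * (l * d ^ 2)) = k₁ ^ 2 * ((Λ * β) * (l * d ^ 2)) := by
    field_simp
  have e3 : (k₂ * s) ^ 2 = 2 * σ * k₂ ^ 2 * β * (1 / (2 * σ * β) * s ^ 2) := by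
    field_simp
  set a := κ / (M * β) * q ^ 2
  set b := η * (l * d ^ 2)
  set c := 1 / (2 * σ * β) * s ^ 2
  have h1 : q ^ 2 ≤ M / κ * β * (a + b + c) := by
    rw [e1]
    exact mul_le_mul_of_nonneg_left (by linarith) (by positivity)
  have h2 : (k₁ * (l * d)) ^ 2 ≤ k₁ ^ 2 * Λ / η * β * (a + b + c) := by
    calc (k₁ * (l * d)) ^ 2 = k₁ ^ 2 * (l * (l * d ^ 2)) := by ring
      _ ≤ k₁ ^ 2 * ((Λ * β) * (l * d ^ 2)) := by gcongr
      _ = k₁ ^ 2 * Λ / η * β * b := e2.symm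
      _ ≤ _ := mul_le_mul_of_nonneg_left (by linarith) (by positivity)
  have h3 : (k₂ * s) ^ 2 ≤ 2 * σ * k₂ ^ 2 * β * (a + b + c) := by
    rw [e3]
    exact mul_le_mul_of_nonneg_left (by linarith) (by positivity)
  have h4 : (q + k₁ * (l * d) + k₂ * s) ^ 2
      ≤ 3 * (q ^ 2 + (k₁ * (l * d)) ^ 2 + (k₂ * s) ^ 2) := by
    linarith [sq_nonneg (q - k₁ * (l * d)), sq_nonneg (q - k₂ * s),
      sq_nonneg (k₁ * (l * d) - k₂ * s)]
  linarith

namespace Iterates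

variable {n r m : ℕ} {D : Problem n r m} {P : Params}

/-- Along every run the criticality measure is a term of order `1 / β^t` plus a quantity whose
square is, relative to the penalty, dominated by the decrease `e` of a bounded potential `F`. The
constants depend on the run only through its initial point. -/
lemma exists_potential (hD : D.Assumptions) (hP : P.Admissible D.Wh)
    (X₀ : MatSp n r) (z₀ : Vec m) :
    ∃ c₀ c₁ V : ℝ, 0 ≤ c₀ ∧ 0 ≤ c₁ ∧ 0 ≤ V ∧
      ∀ R : Iterates n r m, R.X 0 = X₀ → R.z 0 = z₀ → R.IsRunEP D P →
        ∃ F e x : ℕ → ℝ, (∀ t, 0 ≤ e t) ∧ (∀ t, F (t + 1) + e t ≤ F t) ∧ F 0 ≤ V ∧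
          (∀ t, -V ≤ F t) ∧ (∀ t, x t ^ 2 ≤ c₁ * P.β (t + 1) * e t) ∧
          ∀ t, D.crit (R.X (t + 1)) (R.yb (t + 1)) (R.z (t + 1)) ≤ c₀ * (1 / P.β t) + x t := by
  have hθ := hP.one_lt_θ
  have hσ := hP.one_le_σ
  have hσ2 := hP.σ_lt_two
  have h0 := hP.β₀_pos
  have hτ := Params.τ_pos hP
  have hη := Params.primalGain_pos hP
  -- `M β^{t+1}` bounds the model gradient plus its curvature, and serves as `ρ` in the descent.
  obtain ⟨κ, hκ0, hκ⟩ := exists_isStiefelDescentConst r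
  set Bz := max ‖z₀‖ (P.σ * D.Ch / (2 - P.σ)) with hBz
  have hBz0 : 0 ≤ Bz := (norm_nonneg z₀).trans (le_max_left _ _)
  set Bd := 2 * √(r : ℝ) + ‖X₀‖ with hBd
  have hBd0 : 0 ≤ Bd := by positivity
  obtain ⟨V, hV0, hV⟩ := exists_energy_bound hD hP Bz Bd
  set Λ := ‖D.A‖ ^ 2 + D.Lf / P.β₀ with hΛ
  have hΛ0 : 0 ≤ Λ := by positivity
  set M := (D.Cf + D.Cg + 5 * ‖D.A‖ * Bz) / P.β₀ + ((1 + P.θ) * Bd + P.θ) * Λ + 1 with hM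
  have hM0 : 0 < M := by positivity
  set k₁ := (1 + (r : ℝ)) * (1 + P.θ) with hk₁
  set k₂ := (1 + (r : ℝ)) * (2 * ‖D.A‖) + 1 with hk₂
  refine ⟨2 * Bz + P.τ * D.Ch, 3 * (M / κ + k₁ ^ 2 * Λ / P.primalGain + 2 * P.σ * k₂ ^ 2), V,
    by positivity, by positivity, hV0, fun R hX hz hR => ?_⟩
  have hzb : ∀ t, ‖R.z t‖ ≤ Bz := fun t => by
    rw [hBz, ← hz]; exact IsRunEP.norm_z_le hD hP hR t
  have hdb : ∀ t, ‖R.X (t + 1) - R.X t‖ ≤ Bd := fun t => by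
    rw [hBd, ← hX]; exact IsRunEP.norm_dX_le hR t
  have hB : ∀ t, ‖R.z (t + 1) - R.z t‖ ≤ 2 * Bz := fun t => by
    linarith [norm_sub_le (R.z (t + 1)) (R.z t), hzb t, hzb (t + 1)]
  have hb := Params.β_pos hP
  choose v hv hstep using fun t => IsRunEP.energy_step hκ hD hP hR hB t
    (mul_pos hM0 (hb (t + 1))) fun v hv => IsRunEP.norm_modelGrad_le hD hP hR hzb hdb t hv
  obtain ⟨hV1, hV2⟩ := hV R hR hzb hdb
  refine ⟨R.energy D P (2 * Bz), _, fun t =>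
    ‖projTangent (R.X (t + 1)) (R.modelGrad D P (t + 1) (v t))‖
      + k₁ * (D.ell (P.β (t + 1)) * ‖R.X (t + 1) - R.X t‖)
      + k₂ * ‖R.z (t + 1) - R.z t‖, fun t => ?_, hstep, hV1, hV2, fun t => ?_,
    fun t => IsRunEP.crit_le hD hP hR hB t (hv t)⟩
  · have := hb (t + 1)
    have := Problem.ell_nonneg (D := D) this.le
    positivity
  · have hβ := hb (t + 1)
    exact sq_sum_le_mul hκ0 hM0 hη hβ (by linarith) hΛ0 (Problem.ell_nonneg hβ.le)
      (Problem.ell_le hP (t + 1))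

end Iterates

/-- The decreases of a potential with values in `[-V, V]` sum to at most `2 V`. -/
lemma sum_decrease_le {F e : ℕ → ℝ} {V : ℝ} (he : ∀ t, 0 ≤ e t)
    (hF : ∀ t, F (t + 1) + e t ≤ F t) (h0 : F 0 ≤ V) (hV : ∀ t, -V ≤ F t) (T : ℕ) :
    ∑ t ∈ Finset.Icc 1 T, e t ≤ 2 * V := by
  have h1 : ∀ N, F N + ∑ t ∈ Finset.range N, e t ≤ F 0 := by
    intro N
    induction N with
    | zero => simp
    | succ N ih => rw [Finset.sum_range_succ]; linarith [hF N]
  have h2 : ∑ t ∈ Finset.Icc 1 T, e t ≤ ∑ t ∈ Finset.range (T + 1), e t :=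
    Finset.sum_le_sum_of_subset_of_nonneg
      (fun t ht => by rw [Finset.mem_Icc] at ht; rw [Finset.mem_range]; omega)
      fun t _ _ => he t
  linarith [h1 (T + 1), hV (T + 1)]

/-- The averaging argument: Cauchy–Schwarz against the growth of the penalty parameter. -/
lemma average_le {P : Params} {W : ℝ} (hP : P.Admissible W) {c₀ c₁ V : ℝ} (hc₀ : 0 ≤ c₀)
    (hc₁ : 0 ≤ c₁) (hV : 0 ≤ V) {e x a : ℕ → ℝ} (he : ∀ t, 0 ≤ e t)
    (hsum : ∀ T, ∑ t ∈ Finset.Icc 1 T, e t ≤ 2 * V)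
    (hx : ∀ t, x t ^ 2 ≤ c₁ * P.β (t + 1) * e t) (ha : ∀ t, a t ≤ c₀ * (1 / P.β t) + x t)
    {T : ℕ} (hT : 1 ≤ T) :
    1 / (T : ℝ) * ∑ t ∈ Finset.Icc 1 T, a t
      ≤ √(6 * c₁ * P.β₀ * V) * (T : ℝ) ^ ((P.p - 1) / 2)
        + c₀ / (P.β₀ * P.ξ * (1 - P.p)) * (T : ℝ) ^ (-P.p) := by
  have hp := hP.p_pos; have hp1 := hP.p_lt_one; have h0 := hP.β₀_pos; have hξ := hP.ξ_pos
  have hb := Params.β_pos hP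
  have hT0 : (0 : ℝ) < T := by exact_mod_cast hT
  have hq : 0 < 1 - P.p := by linarith
  have h1 : ∑ t ∈ Finset.Icc 1 T, x t ≤ √(6 * c₁ * P.β₀ * V) * (T : ℝ) ^ ((1 + P.p) / 2) := by
    have h2 := Finset.sum_sq_le_sum_mul_sum_of_sq_le_mul (Finset.Icc 1 T)
      (r := x) (f := fun t => c₁ * P.β (t + 1)) (g := e)
      (fun t _ => mul_nonneg hc₁ (hb _).le) (fun t _ => he t) (fun t _ => hx t)
    have h3 : ∑ t ∈ Finset.Icc 1 T, c₁ * P.β (t + 1) ≤ T * (c₁ * (3 * P.β₀ * (T : ℝ) ^ P.p)) := by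
      have h4 := Finset.sum_le_card_nsmul (Finset.Icc 1 T) (fun t => c₁ * P.β (t + 1))
        (c₁ * (3 * P.β₀ * (T : ℝ) ^ P.p)) (fun t ht => by
          rw [Finset.mem_Icc] at ht
          have h5 := (Params.β_mono hP (Nat.succ_le_succ ht.2)).trans (Params.β_le hP hT)
          exact mul_le_mul_of_nonneg_left h5 hc₁)
      simpa using h4
    refine le_of_sq_le_sq (h2.trans ?_) (by positivity)
    have e : (√(6 * c₁ * P.β₀ * V) * (T : ℝ) ^ ((1 + P.p) / 2)) ^ 2
        = T * (c₁ * (3 * P.β₀ * (T : ℝ) ^ P.p)) * (2 * V) := by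
      rw [mul_pow, Real.sq_sqrt (by positivity), ← Real.rpow_natCast, ← Real.rpow_mul hT0.le]
      rw [show (1 + P.p) / 2 * ((2 : ℕ) : ℝ) = 1 + P.p by push_cast; ring,
        Real.rpow_add hT0, Real.rpow_one]
      ring
    rw [e]
    exact mul_le_mul h3 (hsum T) (Finset.sum_nonneg fun t _ => he t) (by positivity)
  have h2 : ∑ t ∈ Finset.Icc 1 T, 1 / P.β t
      ≤ 1 / (P.β₀ * P.ξ) * (1 / (1 - P.p) * (T : ℝ) ^ (1 - P.p)) := by
    calc ∑ t ∈ Finset.Icc 1 T, 1 / P.β t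
        ≤ ∑ t ∈ Finset.Icc 1 T, 1 / (P.β₀ * P.ξ) * (t : ℝ) ^ (-P.p) :=
          Finset.sum_le_sum fun t ht => Params.inv_β_le hP (Finset.mem_Icc.mp ht).1
      _ = 1 / (P.β₀ * P.ξ) * ∑ t ∈ Finset.Icc 1 T, (t : ℝ) ^ (-P.p) := by rw [Finset.mul_sum]
      _ ≤ _ := by gcongr; exact sum_rpow_neg_le hp hp1 T
  have h3 : ∑ t ∈ Finset.Icc 1 T, a t
      ≤ c₀ * (1 / (P.β₀ * P.ξ) * (1 / (1 - P.p) * (T : ℝ) ^ (1 - P.p)))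
        + √(6 * c₁ * P.β₀ * V) * (T : ℝ) ^ ((1 + P.p) / 2) := by
    refine (Finset.sum_le_sum fun t _ => ha t).trans ?_
    rw [Finset.sum_add_distrib, ← Finset.mul_sum]
    gcongr
  refine (mul_le_mul_of_nonneg_left h3 (by positivity)).trans (le_of_eq ?_)
  have e1 : (T : ℝ) ^ ((P.p - 1) / 2) = (T : ℝ) ^ ((1 + P.p) / 2) / T := by
    rw [← Real.rpow_sub_one hT0.ne']; congr 1; ring
  have e2 : (T : ℝ) ^ (-P.p) = (T : ℝ) ^ (1 - P.p) / T := by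
    rw [← Real.rpow_sub_one hT0.ne']; congr 1; ring
  rw [e1, e2]
  field_simp
  ring

/-- The rate `T^{-1/3}` of the averages yields a small term once `T ≥ (C / ε)^3`. -/
lemma exists_le_of_average_le {a : ℕ → ℝ} {C ε : ℝ} (hC : 0 < C) (hε : 0 < ε) {T : ℕ}
    (hT : 1 ≤ T) (hTε : C ^ 3 / ε ^ 3 ≤ (T : ℝ))
    (h : 1 / (T : ℝ) * ∑ t ∈ Finset.Icc 1 T, a t ≤ C * (T : ℝ) ^ (-(1 / 3) : ℝ)) :
    ∃ t, 1 ≤ t ∧ t ≤ T ∧ a t ≤ ε := by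
  have hT0 : (0 : ℝ) < T := by exact_mod_cast hT
  have h1 : C / ε ≤ (T : ℝ) ^ (1 / 3 : ℝ) := by
    have h2 : (C / ε) ^ (3 : ℝ) ≤ T := by
      rw [← div_pow] at hTε
      exact_mod_cast hTε
    calc C / ε = ((C / ε) ^ (3 : ℝ)) ^ (1 / 3 : ℝ) := by
          rw [← Real.rpow_mul (by positivity)]; norm_num
      _ ≤ _ := by gcongr
  have h2 : C * (T : ℝ) ^ (-(1 / 3) : ℝ) ≤ ε := by
    rw [Real.rpow_neg hT0.le, ← div_eq_mul_inv, div_le_iff₀ (by positivity), mul_comm]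
    rwa [div_le_iff₀ hε] at h1
  by_contra! hc
  have h3 : ∑ t ∈ Finset.Icc 1 T, ε < ∑ t ∈ Finset.Icc 1 T, a t := by
    refine Finset.sum_lt_sum_of_nonempty (Finset.nonempty_Icc.mpr hT) fun t ht => ?_
    rw [Finset.mem_Icc] at ht
    exact hc t ht.1 ht.2
  rw [Finset.sum_const, Nat.card_Icc, Nat.add_sub_cancel, nsmul_eq_mul] at h3
  have h4 : 1 / (T : ℝ) * ∑ t ∈ Finset.Icc 1 T, a t ≤ ε := h.trans h2
  rw [one_div_mul_eq_div, div_le_iff₀ hT0] at h4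
  linarith

end OADMM

end

theorem theorem1 {n r m : ℕ} (hnr : r ≤ n)
    (D : OADMM.Problem n r m) (hD : D.Assumptions)
    (P : OADMM.Params) (hP : P.Admissible D.Wh) (hp : P.p = 1 / 3)
    (X₀ : OADMM.MatSp n r) (y₀ z₀ : OADMM.Vec m) :
    ∃ C₁ C₂ C K : ℝ, 0 < C₁ ∧ 0 < C₂ ∧ 0 < C ∧ 0 < K ∧
      ∀ R : OADMM.Iterates n r m, R.X 0 = X₀ → R.y 0 = y₀ → R.z 0 = z₀ → R.IsRunEP D P →
        (∀ T : ℕ, 1 ≤ T →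
          R.avgCrit D T ≤ C₁ * (T : ℝ) ^ ((P.p - 1) / 2) + C₂ * (T : ℝ) ^ (-P.p)) ∧
        (∀ T : ℕ, 1 ≤ T → R.avgCrit D T ≤ C * (T : ℝ) ^ (-(1 / 3) : ℝ)) ∧
        (∀ ε : ℝ, 0 < ε → ∀ T : ℕ, 1 ≤ T → K / ε ^ 3 ≤ (T : ℝ) →
          ∃ t : ℕ, 1 ≤ t ∧ t ≤ T ∧
            D.IsStationary ε (R.X (t + 1)) (R.yb (t + 1)) (R.z (t + 1))) := by
  obtain ⟨c₀, c₁, V, hc₀, hc₁, hV, hrun⟩ := OADMM.Iterates.exists_potential hD hP X₀ z₀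
  have hβ₀ := hP.β₀_pos
  have hξ := hP.ξ_pos
  have hq : 0 < 1 - P.p := by linarith [hP.p_lt_one]
  set A₁ := √(6 * c₁ * P.β₀ * V) with hA₁
  set A₂ := c₀ / (P.β₀ * P.ξ * (1 - P.p)) with hA₂
  have hA₁0 : 0 ≤ A₁ := Real.sqrt_nonneg _
  have hA₂0 : 0 ≤ A₂ := by positivity
  -- The summands `1` make the constants positive, since `A₁` and `A₂` may vanish.
  refine ⟨A₁ + 1, A₂ + 1, A₁ + 1 + (A₂ + 1), (A₁ + 1 + (A₂ + 1)) ^ 3, by positivity,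
    by positivity, by positivity, by positivity, fun R hX _ hz hR => ?_⟩
  obtain ⟨F, e, x, he, hF, hF0, hFV, hx, hcrit⟩ := hrun R hX hz hR
  have h1 : ∀ T : ℕ, 1 ≤ T → R.avgCrit D T
      ≤ (A₁ + 1) * (T : ℝ) ^ ((P.p - 1) / 2) + (A₂ + 1) * (T : ℝ) ^ (-P.p) := fun T hT => by
    refine (OADMM.average_le hP hc₀ hc₁ hV he (OADMM.sum_decrease_le he hF hF0 hFV) hx hcrit
      hT).trans ?_
    gcongr <;> linarith
  have h2 : ∀ T : ℕ, 1 ≤ T → R.avgCrit D T ≤ (A₁ + 1 + (A₂ + 1)) * (T : ℝ) ^ (-(1 / 3) : ℝ) :=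
    fun T hT => by
    have h3 := h1 T hT
    rw [hp, show ((1 : ℝ) / 3 - 1) / 2 = -(1 / 3) by norm_num] at h3
    linarith
  refine ⟨h1, h2, fun ε hε T hT hK => ?_⟩
  obtain ⟨t, ht1, htT, hle⟩ := OADMM.exists_le_of_average_le (by positivity) hε hT hK (h2 T hT)
  exact ⟨t, ht1, htT, OADMM.Iterates.IsRunEP.mem_stiefel hR t, hle⟩
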